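/- Let $A$ and $B$ be unital complex Banach algebras and let $\varphi : A \to B$ be a continuous unital algebra homomorphism. Call a continuous unital homomorphism $f : R \to S$ of Banach algebras \emph{relatively spectral} if there is a dense subalgebra $X \subseteq R$ such that $\mathrm{sp}_S(f(x)) = \mathrm{sp}_R(x)$ for all $x \in X$. Suppose that $\varphi$ has dense image and is \emph{completely relatively spectral}, that is, for every $n \ge 1$ the entrywise map $\mathrm{M}_n(A) \to \mathrm{M}_n(B)$ is relatively spectral (the dense subalgebra of $\mathrm{M}_n(A)$ may depend on $n$). Then: (1) $\varphi$ induces isomorphisms in topological K-theory, $K_0(A) \to K_0(B)$ and $K_{k+1}(A) \to K_{k+1}(B)$ for all $k \ge 0$. Here $K_0(A)$ is the Grothendieck group of the abelian monoid $V(A) = \varinjlim_n \pi_0(\mathrm{Idem}(\mathrm{M}_n(A)))$, where $\mathrm{Idem}$ denotes the space of idempotents, the limit is taken along $p \mapsto \mathrm{diag}(p, 0)$ and the addition is $[p] + [q] = [\mathrm{diag}(p, q)]$; and $K_{k+1}(A) = \varinjlim_n \pi_k(\mathrm{GL}_n(A), 1)$, the limit being taken along $g \mapsto \mathrm{diag}(g,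 1)$. In particular $K_1(A) = \varinjlim_n \pi_0(\mathrm{GL}_n(A))$. (2) $\varphi$ preserves the connected and the general stable ranks: $\mathrm{csr}\, A = \mathrm{csr}\, B$ and $\mathrm{gsr}\, A = \mathrm{gsr}\, B$. Here $\mathrm{Lg}_m(A) = \{(a_1, \dots, a_m) \in A^m : A a_1 + \dots + A a_m = A\}$, on which $\mathrm{GL}_m(A)$ acts by left multiplication on columns; $\mathrm{csr}\, A$ (respectively $\mathrm{gsr}\, A$) is the least $n \ge 1$ such that for all $m \ge n$ the identity component $\mathrm{GL}^0_m(A)$ of $\mathrm{GL}_m(A)$ (respectively $\mathrm{GL}_m(A)$ itself) acts transitively on $\mathrm{Lg}_m(A)$, and it is $\infty$ if there is no such $n$. -/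

import Mathlib

open Matrix Topology

namespace BanachAlg

/-! ### Morphisms of Banach algebras -/

section Morphisms

/-- A unital morphism of topological algebras is relatively spectral if it preserves the spectra of
all elements of some dense subalgebra `X` of its domain. -/
def IsRelativelySpectral {R S : Type*} [Ring R] [Algebra ℂ R] [TopologicalSpace R]
    [Ring S] [Algebra ℂ S] (f : R →ₐ[ℂ] S) : Prop :=
  ∃ X : Subalgebra ℂ R, Dense (X : Set R) ∧ ∀ x ∈ X, spectrum ℂ (f x) = spectrum ℂ x

/-- A Banach algebra morphism `φ : A → B` is completely relatively spectral if each amplification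
`Mₙ(A) → Mₙ(B)` is relatively spectral. The topology on `Mₙ(A)` is the entrywise one, which is the
topology of every Banach algebra norm considered on `Mₙ(A)`. -/
def IsCompletelyRelativelySpectral {A B : Type*} [NormedRing A] [NormedAlgebra ℂ A]
    [NormedRing B] [NormedAlgebra ℂ B] (φ : A →A[ℂ] B) : Prop :=
  ∀ n : ℕ, 1 ≤ n →
    IsRelativelySpectral (AlgHom.mapMatrix (m := Fin n) (φ : A →ₐ[ℂ] B))

end Morphisms

/-! ### Stable ranks -/

section StableRanks

variable (A : Type*) [NormedRing A]

/-- The unimodular `m`-tuples `(a₁, …, aₘ)`: those with `A a₁ + ⋯ + A aₘ = A`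
(`Ideal` means left ideal). -/
def Lg (m : ℕ) : Set (Fin m → A) := {a | Ideal.span (Set.range a) = ⊤}

/-- The subgroup `H` of `GLₘ(A)` acts transitively on the unimodular `m`-tuples, seen as columns. -/
def ActsTransitivelyOnLg (m : ℕ) (H : Subgroup (GL (Fin m) A)) : Prop :=
  ∀ a ∈ Lg A m, ∀ b ∈ Lg A m, ∃ g ∈ H, (g : Matrix (Fin m) (Fin m) A) *ᵥ a = b

/-- The connected stable rank: the least `n ≥ 1` such that the identity component of `GLₘ(A)` acts
transitively on the unimodular `m`-tuples for all `m ≥ n`, and `⊤` if there is no such `n`. -/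
noncomputable def csr : ℕ∞ :=
  ⨅ (n : ℕ) (_ : 1 ≤ n ∧ ∀ m, n ≤ m →
    ActsTransitivelyOnLg A m (Subgroup.connectedComponentOfOne (GL (Fin m) A))), (n : ℕ∞)

/-- The general stable rank: the least `n ≥ 1` such that `GLₘ(A)` acts transitively on the
unimodular `m`-tuples for all `m ≥ n`, and `⊤` if there is no such `n`. -/
noncomputable def gsr : ℕ∞ :=
  ⨅ (n : ℕ) (_ : 1 ≤ n ∧ ∀ m, n ≤ m → ActsTransitivelyOnLg A m ⊤), (n : ℕ∞)

end StableRanks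

/-! ### Corner embeddings `x ↦ diag(x, d)` of square matrices -/

section Corner

variable {A : Type*} [NormedRing A]

/-- The matrix `diag(x, d, …, d)` of size `N ≥ n`. -/
def pad {n N : ℕ} (_h : n ≤ N) (d : A) (x : Matrix (Fin n) (Fin n) A) :
    Matrix (Fin N) (Fin N) A :=
  fun i j => if hij : (i : ℕ) < n ∧ (j : ℕ) < n then x ⟨i, hij.1⟩ ⟨j, hij.2⟩
    else if i = j then d else 0

lemma pad_self {n : ℕ} (h : n ≤ n) (d : A) (x : Matrix (Fin n) (Fin n) A) : pad h d x = x := by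
  ext i j; simp [pad]

lemma pad_pad {n N M : ℕ} (h : n ≤ N) (h' : N ≤ M) (d : A) (x : Matrix (Fin n) (Fin n) A) :
    pad h' d (pad h d x) = pad (h.trans h') d x := by
  ext i j
  simp only [pad, Fin.ext_iff]
  grind

lemma pad_add_eq {n k : ℕ} (h : n ≤ n + k) (d : A) (x : Matrix (Fin n) (Fin n) A) :
    pad h d x = (fromBlocks x 0 0 (diagonal fun _ : Fin k => d)).submatrix
      finSumFinEquiv.symm finSumFinEquiv.symm := by
  ext i j
  induction i using Fin.addCases <;> induction j using Fin.addCases <;>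
    simp [pad, diagonal_apply, Fin.ext_iff]
  all_goals grind

lemma pad_mul {n N : ℕ} (h : n ≤ N) {d e : A} (x y : Matrix (Fin n) (Fin n) A) :
    pad h d x * pad h e y = pad h (d * e) (x * y) := by
  obtain ⟨k, rfl⟩ := Nat.exists_eq_add_of_le h
  simp [pad_add_eq, submatrix_mul_equiv, fromBlocks_multiply]

lemma pad_one {n N : ℕ} (h : n ≤ N) : pad h (1 : A) 1 = 1 := by
  ext i j
  simp only [pad, one_apply, Fin.ext_iff]
  grind

lemma continuous_pad {n N : ℕ} (h : n ≤ N) (d : A) :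
    Continuous (pad h d : Matrix (Fin n) (Fin n) A → _) := by
  refine continuous_matrix fun i j => ?_
  unfold pad
  split_ifs <;> fun_prop

lemma pad_map {B : Type*} [NormedRing B] (φ : A →+* B) {n N : ℕ} (h : n ≤ N) (d : A)
    (x : Matrix (Fin n) (Fin n) A) : (pad h d x).map φ = pad h (φ d) (x.map φ) := by
  ext i j
  simp only [pad, map_apply]
  split_ifs <;> simp

end Corner

/-! ### The monoid `V(A)` and the group `K₀(A)` -/

section KZero

/-- The space of idempotents of `Mₙ(A)`, with the subspace topology. -/
abbrev Idem (A : Type*) [NormedRing A] (n : ℕ) : Type _ :=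
  {p : Matrix (Fin n) (Fin n) A // IsIdempotentElem p}

/-- The idempotent `0` of size `n`. -/
def Idem.zero (A : Type*) [NormedRing A] (n : ℕ) : Idem A n := ⟨0, IsIdempotentElem.zero⟩

variable {A : Type*} [NormedRing A]

/-- The embedding `p ↦ diag(p, 0)`. -/
def Idem.pad {n N : ℕ} (h : n ≤ N) (p : Idem A n) : Idem A N :=
  ⟨BanachAlg.pad h 0 p.1, by
    have := pad_mul h (d := (0 : A)) (e := 0) p.1 p.1
    rwa [p.2.eq, mul_zero] at this⟩

lemma Idem.continuous_pad {n N : ℕ} (h : n ≤ N) : Continuous (Idem.pad h : Idem A n → _) :=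
  ((BanachAlg.continuous_pad h 0).comp continuous_subtype_val).subtype_mk _

lemma Idem.pad_pad {n N M : ℕ} (h : n ≤ N) (h' : N ≤ M) (p : Idem A n) :
    (p.pad h).pad h' = p.pad (h.trans h') := Subtype.ext (BanachAlg.pad_pad h h' 0 p.1)

lemma joined_map {X Y : Type*} [TopologicalSpace X] [TopologicalSpace Y] {f : X → Y}
    (hf : Continuous f) {x y : X} (h : Joined x y) : Joined (f x) (f y) :=
  ⟨h.somePath.map hf⟩

/-- Two idempotent matrices, possibly of different sizes, have the same class in the direct limit
of the sets of path components `π₀(Idem(Mₙ(A)))` along `p ↦ diag(p, 0)`: they can be joined by a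
path of idempotents after some stabilization. -/
def stableSetoid (A : Type*) [NormedRing A] : Setoid (Σ n, Idem A n) where
  r p q := ∃ (N : ℕ) (hp : p.1 ≤ N) (hq : q.1 ≤ N), Joined (p.2.pad hp) (q.2.pad hq)
  iseqv := by
    refine ⟨fun p => ⟨p.1, le_rfl, le_rfl, Joined.refl _⟩,
      fun ⟨N, hp, hq, h⟩ => ⟨N, hq, hp, h.symm⟩, ?_⟩
    rintro p q r ⟨N, hp, hq, h⟩ ⟨M, hq', hr, h'⟩
    refine ⟨max N M, hp.trans (le_max_left _ _), hr.trans (le_max_right _ _), ?_⟩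
    have h1 := joined_map (Idem.continuous_pad (le_max_left N M)) h
    have h2 := joined_map (Idem.continuous_pad (le_max_right N M)) h'
    simp only [Idem.pad_pad] at h1 h2
    exact h1.trans h2

/-- `V(A) = lim π₀(Idem(Mₙ(A)))`. -/
def V (A : Type*) [NormedRing A] : Type _ := Quotient (stableSetoid A)

/-- The class in `V(A)` of an idempotent matrix. -/
def V.mk {n : ℕ} (p : Idem A n) : V A := Quotient.mk (stableSetoid A) ⟨n, p⟩

/-- The block sum `diag(p, q)`. -/
def Idem.sum {m n : ℕ} (p : Idem A m) (q : Idem A n) : Idem A (m + n) :=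
  ⟨(fromBlocks p.1 0 0 q.1).submatrix finSumFinEquiv.symm finSumFinEquiv.symm, by
    have hp := p.2.eq
    have hq := q.2.eq
    simp [IsIdempotentElem, submatrix_mul_equiv, fromBlocks_multiply, hp, hq]⟩

/-- Auxiliary algebraic relation: `p = x y` and `q = y x` for some rectangular `x`, `y`. It is only
used to verify the monoid laws of `V(A)`. -/
def AlgEquivalent {ι κ : Type*} [Fintype ι] [Fintype κ] (p : Matrix ι ι A) (q : Matrix κ κ A) :
    Prop :=
  ∃ (x : Matrix ι κ A) (y : Matrix κ ι A), x * y = p ∧ y * x = q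

section AlgEquivalent

variable {ι κ μ : Type*} [Fintype ι] [Fintype κ] [Fintype μ]

lemma AlgEquivalent.symm {p : Matrix ι ι A} {q : Matrix κ κ A} (h : AlgEquivalent p q) :
    AlgEquivalent q p := let ⟨x, y, h1, h2⟩ := h; ⟨y, x, h2, h1⟩

lemma AlgEquivalent.refl {p : Matrix ι ι A} (h : IsIdempotentElem p) : AlgEquivalent p p :=
  ⟨p, p, h, h⟩

lemma AlgEquivalent.trans {p : Matrix ι ι A} {q : Matrix κ κ A} {r : Matrix μ μ A}
    (hp : IsIdempotentElem p) (hr : IsIdempotentElem r)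
    (h : AlgEquivalent p q) (h' : AlgEquivalent q r) : AlgEquivalent p r := by
  obtain ⟨x, y, rfl, rfl⟩ := h
  obtain ⟨z, w, h1, rfl⟩ := h'
  refine ⟨x * z, w * y, ?_, ?_⟩
  · calc x * z * (w * y) = x * (z * w) * y := by simp only [Matrix.mul_assoc]
      _ = x * y * (x * y) := by rw [h1]; simp only [Matrix.mul_assoc]
      _ = x * y := hp
  · calc w * y * (x * z) = w * (y * x) * z := by simp only [Matrix.mul_assoc]
      _ = w * z * (w * z) := by rw [← h1]; simp only [Matrix.mul_assoc]
      _ = w * z := hr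

lemma AlgEquivalent.submatrix (p : Matrix ι ι A) (hp : IsIdempotentElem p) (e : κ ≃ ι) :
    AlgEquivalent (p.submatrix e e) p := by
  refine ⟨p.submatrix e id, p.submatrix id e, ?_, ?_⟩
  · rw [← submatrix_mul p p e id e Function.bijective_id, hp.eq]
  · rw [← submatrix_mul p p id e id e.bijective, hp.eq, submatrix_id_id]

lemma AlgEquivalent.fromBlocks {ι' κ' : Type*} [Fintype ι'] [Fintype κ']
    {p : Matrix ι ι A} {q : Matrix κ κ A} {p' : Matrix ι' ι' A} {q' : Matrix κ' κ' A}
    (h : AlgEquivalent p q) (h' : AlgEquivalent p' q') :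
    AlgEquivalent (fromBlocks p 0 0 p') (fromBlocks q 0 0 q') := by
  obtain ⟨x, y, rfl, rfl⟩ := h
  obtain ⟨z, w, rfl, rfl⟩ := h'
  exact ⟨Matrix.fromBlocks x 0 0 z, Matrix.fromBlocks y 0 0 w, by simp [fromBlocks_multiply],
    by simp [fromBlocks_multiply]⟩

lemma AlgEquivalent.fromBlocks_comm {p : Matrix ι ι A} {q : Matrix κ κ A}
    (hp : IsIdempotentElem p) (hq : IsIdempotentElem q) :
    AlgEquivalent (Matrix.fromBlocks p 0 0 q) (Matrix.fromBlocks q 0 0 p) :=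
  ⟨Matrix.fromBlocks 0 p q 0, Matrix.fromBlocks 0 q p 0,
    by simp [fromBlocks_multiply, hp.eq, hq.eq], by simp [fromBlocks_multiply, hp.eq, hq.eq]⟩

lemma AlgEquivalent.fromBlocks_zero {p : Matrix ι ι A} (hp : IsIdempotentElem p) :
    AlgEquivalent (Matrix.fromBlocks p 0 0 (0 : Matrix κ κ A)) p :=
  ⟨fromRows p 0, fromCols p 0,
    by rw [fromRows_mul_fromCols]; simp [hp.eq], by simp [fromCols_mul_fromRows, hp.eq]⟩

lemma isIdempotentElem_fromBlocks {p : Matrix ι ι A} {q : Matrix κ κ A}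
    (hp : IsIdempotentElem p) (hq : IsIdempotentElem q) :
    IsIdempotentElem (Matrix.fromBlocks p 0 0 q) := by
  simp [IsIdempotentElem, fromBlocks_multiply, hp.eq, hq.eq]

end AlgEquivalent

lemma Idem.algEquivalent_sum {m n : ℕ} (p : Idem A m) (q : Idem A n) :
    AlgEquivalent (p.sum q).1 (fromBlocks p.1 0 0 q.1) :=
  AlgEquivalent.submatrix _ (isIdempotentElem_fromBlocks p.2 q.2) _

lemma Idem.algEquivalent_pad {n N : ℕ} (h : n ≤ N) (p : Idem A n) :
    AlgEquivalent (p.pad h).1 p.1 := by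
  obtain ⟨k, rfl⟩ := Nat.exists_eq_add_of_le h
  have hp := isIdempotentElem_fromBlocks p.2 (IsIdempotentElem.zero (M₀ := Matrix (Fin k) (Fin k) A))
  have : (p.pad h).1 = (Matrix.fromBlocks p.1 0 0 (0 : Matrix (Fin k) (Fin k) A)).submatrix
      finSumFinEquiv.symm finSumFinEquiv.symm := by
    simp [Idem.pad, pad_add_eq]
  exact AlgEquivalent.trans (p.pad h).2 p.2 (this ▸ AlgEquivalent.submatrix _ hp _)
    (AlgEquivalent.fromBlocks_zero p.2)

lemma Idem.sum_zero_eq_pad {m n : ℕ} (p : Idem A m) :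
    p.sum (Idem.zero A n) = p.pad (Nat.le_add_right m n) := by
  apply Subtype.ext
  simp [Idem.zero, Idem.pad, Idem.sum, pad_add_eq]

lemma V.mk_pad {n N : ℕ} (h : n ≤ N) (p : Idem A n) : V.mk (p.pad h) = V.mk p :=
  Quotient.sound ⟨N, le_rfl, h, by rw [Idem.pad_pad]⟩

lemma V.mk_eq_of_joined {n : ℕ} {p q : Idem A n} (h : Joined p q) : V.mk p = V.mk q :=
  Quotient.sound ⟨n, le_rfl, le_rfl, joined_map (Idem.continuous_pad _) h⟩

lemma Idem.sum_continuous_left {m n : ℕ} (q : Idem A n) :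
    Continuous fun p : Idem A m => p.sum q := by
  refine Continuous.subtype_mk (Continuous.matrix_submatrix ?_ _ _) _
  apply Continuous.matrix_fromBlocks <;> fun_prop

lemma Idem.sum_continuous_right {m n : ℕ} (p : Idem A m) :
    Continuous fun q : Idem A n => p.sum q := by
  refine Continuous.subtype_mk (Continuous.matrix_submatrix ?_ _ _) _
  apply Continuous.matrix_fromBlocks <;> fun_prop

variable [NormedAlgebra ℂ A]

/-- If `p = x y` and `q = y x` are idempotents then `diag(p, 0)` and `diag(0, q)` are joined by a
path of idempotents. -/
lemma Idem.joined_of_algEquivalent {m n : ℕ} (p : Idem A m) (q : Idem A n)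
    (h : AlgEquivalent p.1 q.1) :
    Joined (p.sum (Idem.zero A n))
      (Idem.sum (Idem.zero A m) q) := by
  obtain ⟨x, y, hxy, hyx⟩ := h
  obtain ⟨p, hp⟩ := p
  obtain ⟨q, hq⟩ := q
  dsimp only at hxy hyx
  have hp' := hp.eq
  have hq' := hq.eq
  -- replace `x`, `y` by `p x q`, `q y p`
  obtain ⟨u, v, huv, hvu, hpu, huq, hqv, hvp⟩ : ∃ (u : Matrix (Fin m) (Fin n) A)
      (v : Matrix (Fin n) (Fin m) A), u * v = p ∧ v * u = q ∧ p * u = u ∧ u * q = u ∧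
        q * v = v ∧ v * p = v := by
    refine ⟨p * x, y * p, ?_, ?_, ?_, ?_, ?_, ?_⟩
    · calc p * x * (y * p) = p * (x * y) * p := by simp only [Matrix.mul_assoc]
        _ = p := by rw [hxy, hp', hp']
    · calc y * p * (p * x) = y * (p * p) * x := by simp only [Matrix.mul_assoc]
        _ = (y * x) * (y * x) := by rw [hp', ← hxy]; simp only [Matrix.mul_assoc]
        _ = q := by rw [hyx, hq']
    · rw [← Matrix.mul_assoc, hp']
    · calc p * x * q = p * (x * y) * x := by rw [← hyx]; simp only [Matrix.mul_assoc]
        _ = p * x := by rw [hxy, hp']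
    · calc q * (y * p) = y * (x * y) * p := by rw [← hyx]; simp only [Matrix.mul_assoc]
        _ = y * p := by rw [hxy, Matrix.mul_assoc, hp']
    · rw [Matrix.mul_assoc, hp']
  let c : unitInterval → ℂ := fun t => Complex.cos (((t : ℝ) : ℂ) * (Real.pi / 2))
  let s : unitInterval → ℂ := fun t => Complex.sin (((t : ℝ) : ℂ) * (Real.pi / 2))
  have hcs : ∀ t, s t ^ 2 + c t ^ 2 = 1 := fun t => Complex.sin_sq_add_cos_sq _
  have hc : Continuous c := by fun_prop
  have hs : Continuous s := by fun_prop
  let E : unitInterval → Matrix (Fin m ⊕ Fin n) (Fin m ⊕ Fin n) A := fun t =>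
    Matrix.fromBlocks ((c t ^ 2) • p) ((c t * s t) • u) ((c t * s t) • v) ((s t ^ 2) • q)
  have hE : ∀ t, E t * E t = E t := by
    intro t
    have h1 := hcs t
    simp only [E, fromBlocks_multiply, Matrix.smul_mul, Matrix.mul_smul, smul_smul, hp', hq',
      huv, hvu, hpu, huq, hqv, hvp, ← add_smul]
    congr 2
    · linear_combination (c t ^ 2) * h1
    · linear_combination (c t * s t) * h1
    · linear_combination (c t * s t) * h1
    · linear_combination (s t ^ 2) * h1
  have hEc : Continuous E := by
    apply Continuous.matrix_fromBlocks <;> fun_prop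
  refine ⟨⟨⟨fun t => ⟨(E t).submatrix finSumFinEquiv.symm finSumFinEquiv.symm, ?_⟩, ?_⟩, ?_, ?_⟩⟩
  · simp only [IsIdempotentElem, submatrix_mul_equiv, hE t]
  · exact (hEc.matrix_submatrix _ _).subtype_mk _
  · apply Subtype.ext
    simp [E, c, s, Idem.sum, Idem.zero]
  · apply Subtype.ext
    simp [E, c, s, Idem.sum, Idem.zero]

lemma V.mk_eq_of_algEquivalent {m n : ℕ} (p : Idem A m) (q : Idem A n)
    (h : AlgEquivalent p.1 q.1) : V.mk p = V.mk q := by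
  have key : ∀ {k l : ℕ} (p : Idem A k) (q : Idem A l), AlgEquivalent p.1 q.1 →
      V.mk p = V.mk (Idem.sum (Idem.zero A k) q) := by
    intro k l p q h
    rw [← V.mk_eq_of_joined (Idem.joined_of_algEquivalent p q h), Idem.sum_zero_eq_pad, V.mk_pad]
  have h2 := key (q.pad (Nat.le_max_right m n)) q (Idem.algEquivalent_pad _ _)
  have h1 := key (p.pad (Nat.le_max_left m n)) q
    (AlgEquivalent.trans (Idem.pad _ p).2 q.2 (Idem.algEquivalent_pad _ _) h)
  rw [V.mk_pad] at h1 h2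
  rw [h1, h2]

lemma V.mk_sum_congr {m n m' n' : ℕ} {p : Idem A m} {q : Idem A n} {p' : Idem A m'}
    {q' : Idem A n'} (hp : V.mk p = V.mk p') (hq : V.mk q = V.mk q') :
    V.mk (p.sum q) = V.mk (p'.sum q') := by
  have pads : ∀ {m n M N : ℕ} (hm : m ≤ M) (hn : n ≤ N) (p : Idem A m) (q : Idem A n),
      V.mk (p.sum q) = V.mk ((p.pad hm).sum (q.pad hn)) := by
    intro m n M N hm hn p q
    apply V.mk_eq_of_algEquivalent
    have h1 := isIdempotentElem_fromBlocks p.2 q.2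
    have h2 := AlgEquivalent.fromBlocks (Idem.algEquivalent_pad hm p).symm
      (Idem.algEquivalent_pad hn q).symm
    refine AlgEquivalent.trans (Idem.sum _ _).2 (Idem.sum _ _).2 (Idem.algEquivalent_sum p q)
      (AlgEquivalent.trans h1 (Idem.sum _ _).2 h2 (Idem.algEquivalent_sum _ _).symm)
  obtain ⟨N, h1, h2, h⟩ := Quotient.exact hp
  obtain ⟨M, h3, h4, h'⟩ := Quotient.exact hq
  rw [pads h1 h3 p q, pads h2 h4 p' q']
  exact (V.mk_eq_of_joined (joined_map (Idem.sum_continuous_left _) h)).trans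
    (V.mk_eq_of_joined (joined_map (Idem.sum_continuous_right _) h'))

/-- The addition `[p] + [q] = [diag(p, q)]` on `V(A)`. -/
instance : Add (V A) where
  add := Quotient.map₂ (fun p q => ⟨p.1 + q.1, p.2.sum q.2⟩) fun _ _ h _ _ h' =>
    Quotient.exact (V.mk_sum_congr (Quotient.sound h) (Quotient.sound h'))

instance : Zero (V A) where
  zero := V.mk (Idem.zero A 0)

lemma V.mk_add_mk {m n : ℕ} (p : Idem A m) (q : Idem A n) : V.mk p + V.mk q = V.mk (p.sum q) := rfl

/-- `V(A)` is an abelian monoid. -/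
instance : AddCommMonoid (V A) where
  add_assoc := by
    rintro ⟨_, p⟩ ⟨_, q⟩ ⟨_, r⟩
    change V.mk ((p.sum q).sum r) = V.mk (p.sum (q.sum r))
    apply V.mk_eq_of_algEquivalent
    have hpq := isIdempotentElem_fromBlocks p.2 q.2
    have hqr := isIdempotentElem_fromBlocks q.2 r.2
    have h1 := isIdempotentElem_fromBlocks hpq r.2
    have h2 := isIdempotentElem_fromBlocks p.2 hqr
    have e1 := AlgEquivalent.trans (Idem.sum _ _).2 h1 (Idem.algEquivalent_sum (p.sum q) r)
      (AlgEquivalent.fromBlocks (Idem.algEquivalent_sum p q) (AlgEquivalent.refl r.2))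
    have e2 := AlgEquivalent.trans (Idem.sum _ _).2 h2 (Idem.algEquivalent_sum p (q.sum r))
      (AlgEquivalent.fromBlocks (AlgEquivalent.refl p.2) (Idem.algEquivalent_sum q r))
    have e3 := AlgEquivalent.submatrix _ h2 (Equiv.sumAssoc _ _ _)
    have : (fromBlocks p.1 0 0 (fromBlocks q.1 0 0 r.1)).submatrix
        (Equiv.sumAssoc _ _ _) (Equiv.sumAssoc _ _ _) =
        fromBlocks (fromBlocks p.1 0 0 q.1) 0 0 r.1 := by
      ext (( i | i) | i) ((j | j) | j) <;> simp
    rw [this] at e3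
    exact AlgEquivalent.trans (Idem.sum _ _).2 (Idem.sum _ _).2 e1
      (AlgEquivalent.trans h1 (Idem.sum _ _).2 e3 e2.symm)
  zero_add := by
    rintro ⟨_, p⟩
    change V.mk (Idem.sum _ p) = V.mk p
    apply V.mk_eq_of_algEquivalent
    have h0 := isIdempotentElem_fromBlocks
      (IsIdempotentElem.zero (M₀ := Matrix (Fin 0) (Fin 0) A)) p.2
    exact AlgEquivalent.trans (Idem.sum _ _).2 p.2 (Idem.algEquivalent_sum _ p)
      (AlgEquivalent.trans h0 p.2 (AlgEquivalent.fromBlocks_comm IsIdempotentElem.zero p.2)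
        (AlgEquivalent.fromBlocks_zero p.2))
  add_zero := by
    rintro ⟨_, p⟩
    change V.mk (Idem.sum p _) = V.mk p
    apply V.mk_eq_of_algEquivalent
    exact AlgEquivalent.trans (Idem.sum _ _).2 p.2 (Idem.algEquivalent_sum p _)
      (AlgEquivalent.fromBlocks_zero p.2)
  add_comm := by
    rintro ⟨_, p⟩ ⟨_, q⟩
    change V.mk (p.sum q) = V.mk (q.sum p)
    apply V.mk_eq_of_algEquivalent
    exact AlgEquivalent.trans (Idem.sum _ _).2 (Idem.sum _ _).2 (Idem.algEquivalent_sum p q)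
      (AlgEquivalent.trans (isIdempotentElem_fromBlocks p.2 q.2) (Idem.sum _ _).2
        (AlgEquivalent.fromBlocks_comm p.2 q.2) (Idem.algEquivalent_sum q p).symm)
  nsmul := nsmulRec

/-- `K₀(A)`, the Grothendieck group of the abelian monoid `V(A)`. -/
abbrev KZero (A : Type*) [NormedRing A] [NormedAlgebra ℂ A] : Type _ :=
  Algebra.GrothendieckAddGroup (V A)

variable {B : Type*} [NormedRing B] [NormedAlgebra ℂ B]

/-- A morphism applied to the entries of an idempotent matrix. -/
def Idem.map (φ : A →A[ℂ] B) {n : ℕ} (p : Idem A n) : Idem B n :=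
  ⟨p.1.map φ, (p.2.map (AlgHom.mapMatrix (m := Fin n) (φ : A →ₐ[ℂ] B)))⟩

lemma Idem.continuous_map (φ : A →A[ℂ] B) {n : ℕ} :
    Continuous (Idem.map φ : Idem A n → Idem B n) :=
  (continuous_subtype_val.matrix_map φ.continuous).subtype_mk _

lemma Idem.map_pad (φ : A →A[ℂ] B) {n N : ℕ} (h : n ≤ N) (p : Idem A n) :
    (p.pad h).map φ = (p.map φ).pad h := by
  apply Subtype.ext
  have := BanachAlg.pad_map (φ : A →+* B) h 0 p.1
  rw [map_zero] at this
  exact this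

/-- The monoid morphism `V(A) → V(B)`, `[p] ↦ [φ(p)]`, induced by a Banach algebra morphism. -/
def V.map (φ : A →A[ℂ] B) : V A →+ V B where
  toFun := Quotient.map (fun p => ⟨p.1, p.2.map φ⟩) fun p q ⟨N, hp, hq, h⟩ =>
    ⟨N, hp, hq, by
      have := joined_map (Idem.continuous_map φ) h
      rwa [Idem.map_pad, Idem.map_pad] at this⟩
  map_zero' := congrArg V.mk (Subtype.ext (Subsingleton.elim _ _))
  map_add' := by
    rintro ⟨_, p⟩ ⟨_, q⟩
    change V.mk ((p.sum q).map φ) = V.mk ((p.map φ).sum (q.map φ))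
    congr 1
    apply Subtype.ext
    simp only [Idem.map, Idem.sum, ← submatrix_map, fromBlocks_map]
    simp

/-- The homomorphism `K₀(A) → K₀(B)` induced by a Banach algebra morphism. -/
noncomputable def KZero.map (φ : A →A[ℂ] B) : KZero A →+ KZero B :=
  Algebra.GrothendieckAddGroup.lift (Algebra.GrothendieckAddGroup.of.comp (V.map φ))

end KZero

/-! ### Homotopy groups of topological groups and the groups `K_{k+1}(A)` -/

section Pi

/-- The group of `k`-dimensional loops in a topological group `G` based at `1`, that is of
continuous maps `[0,1]ᵏ → G` that send the boundary to `1`, under pointwise multiplication. -/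
def loopGroup (k : ℕ) (G : Type*) [Group G] [TopologicalSpace G] [IsTopologicalGroup G] :
    Subgroup C(Fin k → unitInterval, G) where
  carrier := GenLoop (Fin k) G 1
  one_mem' := fun _ _ => rfl
  mul_mem' := fun {f g} hf hg y hy => by
    rw [ContinuousMap.mul_apply, hf y hy, hg y hy, one_mul]
  inv_mem' := fun {f} hf y hy => by
    rw [ContinuousMap.inv_apply, hf y hy, inv_one]

variable (k : ℕ) (G : Type*) [Group G] [TopologicalSpace G] [IsTopologicalGroup G]
  {H : Type*} [Group H] [TopologicalSpace H] [IsTopologicalGroup H]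

/-- Homotopy of loops relative to the boundary, a congruence of the loop group. -/
def loopCon : Con (loopGroup k G) where
  toSetoid := GenLoop.Homotopic.setoid (Fin k) (1 : G)
  mul' := by
    rintro f f' g g' ⟨h⟩ ⟨h'⟩
    refine ⟨⟨⟨h.toContinuousMap * h'.toContinuousMap, fun x => ?_, fun x => ?_⟩,
      fun t x hx => ?_⟩⟩
    · exact congrArg₂ (· * ·) (h.apply_zero x) (h'.apply_zero x)
    · exact congrArg₂ (· * ·) (h.apply_one x) (h'.apply_one x)
    · exact congrArg₂ (· * ·) (h.prop' t x hx) (h'.prop' t x hx)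

/-- The homotopy group `π_k(G, 1)` of a topological group, for all `k ≥ 0`, with the group law
given by the pointwise product of loops. For `k = 0` this is the group of path components of `G`;
for `k ≥ 1` it is the usual homotopy group, with the same group law, see `PiGroup.mulEquivPi`. -/
def PiGroup : Type _ := (loopCon k G).Quotient

instance : Group (PiGroup k G) := inferInstanceAs (Group (loopCon k G).Quotient)

lemma PiGroup.mul_eq (a b : PiGroup (k + 1) G) :
    (a * b : PiGroup (k + 1) G) =
      (HMul.hMul (α := HomotopyGroup.Pi (k + 1) G 1) (β := HomotopyGroup.Pi (k + 1) G 1) a b :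
        HomotopyGroup.Pi (k + 1) G 1) := by
  have key := EckmannHilton.mul (X := HomotopyGroup.Pi (k + 1) G 1)
    (m₁ := fun a b => HMul.hMul (α := PiGroup (k + 1) G) (β := PiGroup (k + 1) G) a b)
    (m₂ := fun a b => a * b) (e₁ := (1 : PiGroup (k + 1) G)) (e₂ := 1)
    { left_id := fun a => one_mul (M := PiGroup (k + 1) G) a
      right_id := fun a => mul_one (M := PiGroup (k + 1) G) a }
    { left_id := fun a => one_mul a
      right_id := fun a => mul_one a }
    (by
      rintro ⟨a⟩ ⟨b⟩ ⟨c⟩ ⟨d⟩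
      have e := fun p q : GenLoop (Fin (k + 1)) G 1 =>
        HomotopyGroup.mul_spec (i := (0 : Fin (k + 1))) (p := p) (q := q)
      let mulL : GenLoop (Fin (k + 1)) G 1 → GenLoop (Fin (k + 1)) G 1 →
        GenLoop (Fin (k + 1)) G 1 :=
        HMul.hMul (α := loopGroup (k + 1) G) (β := loopGroup (k + 1) G)
      refine (congrArg₂ (HMul.hMul (α := PiGroup (k + 1) G) (β := PiGroup (k + 1) G))
        (e a b) (e c d)).trans (Eq.trans ?_ (e (mulL a c) (mulL b d)).symm)
      refine congrArg (Quotient.mk (GenLoop.Homotopic.setoid (Fin (k + 1)) (1 : G))) ?_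
      change mulL _ _ = _
      apply GenLoop.ext
      intro y
      have hm : ∀ (p q : GenLoop (Fin (k + 1)) G 1) y, mulL p q y = p y * q y := fun _ _ _ => rfl
      rw [hm]
      simp only [GenLoop.transAt, GenLoop.coe_copy, hm]
      split_ifs <;> rfl)
  exact congrFun (congrFun key a) b

/-- For `k ≥ 1`, the group `π_k(G, 1)` above is the `k`-th homotopy group of Mathlib. -/
def PiGroup.mulEquivPi : PiGroup (k + 1) G ≃* HomotopyGroup.Pi (k + 1) G 1 where
  toFun := id
  invFun := id
  left_inv _ := rfl
  right_inv _ := rfl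
  map_mul' := PiGroup.mul_eq k G

variable {G}

/-- The class in `π_k(G, 1)` of a loop. -/
def PiGroup.mk : loopGroup k G →* PiGroup k G := (loopCon k G).mk'

/-- Composition of loops with a continuous homomorphism. -/
def loopGroup.map (f : G →ₜ* H) : loopGroup k G →* loopGroup k H where
  toFun u := ⟨(f : C(G, H)).comp u.1, fun y hy => (congrArg f (u.2 y hy)).trans (map_one f)⟩
  map_one' := Subtype.ext (ContinuousMap.ext fun _ => map_one f)
  map_mul' _ _ := Subtype.ext (ContinuousMap.ext fun _ => map_mul f _ _)

/-- The homomorphism `π_k(G) → π_k(H)`, `[u] ↦ [f ∘ u]`, induced by a continuous homomorphism. -/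
def PiGroup.map (f : G →ₜ* H) : PiGroup k G →* PiGroup k H :=
  Con.lift (loopCon k G) ((PiGroup.mk k).comp (loopGroup.map k f)) <| by
    rintro u v ⟨h⟩
    refine (Con.eq (loopCon k H)).2 ⟨⟨⟨(f : C(G, H)).comp h.toContinuousMap, fun x => ?_,
      fun x => ?_⟩, fun t x hx => ?_⟩⟩
    · exact congrArg f (h.apply_zero x)
    · exact congrArg f (h.apply_one x)
    · exact congrArg f (h.prop' t x hx)

lemma PiGroup.map_mk (f : G →ₜ* H) (u : loopGroup k G) :
    PiGroup.map k f (PiGroup.mk k u) = PiGroup.mk k (loopGroup.map k f u) := rfl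

lemma PiGroup.mk_surjective : Function.Surjective (PiGroup.mk k : loopGroup k G →* _) :=
  Con.mk'_surjective

end Pi

section KHigher

/-- The embedding `GLₙ(A) → GL_N(A)`, `g ↦ diag(g, 1)`, for `n ≤ N`. -/
def glPad (A : Type*) [NormedRing A] {n N : ℕ} (h : n ≤ N) :
    GL (Fin n) A →ₜ* GL (Fin N) A where
  toMonoidHom := Units.map
    { toFun := pad h 1
      map_one' := pad_one h
      map_mul' := fun x y => by rw [pad_mul, mul_one] }
  continuous_toFun := Units.continuous_map (continuous_pad h 1)

/-- The homotopy groups `π_k(GLₙ(A))` form a directed system along the embeddings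
`g ↦ diag(g, 1)`. -/
instance directedSystem_piGroup (A : Type*) [NormedRing A] (k : ℕ) :
    DirectedSystem (fun n : ℕ => PiGroup k (GL (Fin n) A))
      (fun _ _ h => ⇑(PiGroup.map k (glPad A h))) where
  map_self n x := by
    obtain ⟨u, rfl⟩ := PiGroup.mk_surjective k x
    rw [PiGroup.map_mk]
    congr 1
    ext y : 2
    exact Units.ext (pad_self (le_refl n) (1 : A) _)
  map_map _ _ _ hij hjk x := by
    obtain ⟨u, rfl⟩ := PiGroup.mk_surjective k x
    rw [PiGroup.map_mk, PiGroup.map_mk, PiGroup.map_mk]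
    congr 1
    ext y : 2
    exact Units.ext (pad_pad hij hjk (1 : A) _)

/-- The topological K-group `K_{k+1}(A) = lim π_k(GLₙ(A))`, the direct limit along the embeddings
`g ↦ diag(g, 1)`. In particular `KSucc A 0` is `K₁(A) = lim π₀(GLₙ(A))`. -/
abbrev KSucc (A : Type*) [NormedRing A] (k : ℕ) : Type _ :=
  DirectLimit (fun n : ℕ => PiGroup k (GL (Fin n) A))
    (fun _ _ h => PiGroup.map k (glPad A h))

variable {A B : Type*} [NormedRing A] [NormedAlgebra ℂ A] [NormedRing B] [NormedAlgebra ℂ B]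

/-- The continuous homomorphism `GLₙ(A) → GLₙ(B)` given by applying a Banach algebra morphism to
the entries. -/
def glMap (φ : A →A[ℂ] B) (n : ℕ) : GL (Fin n) A →ₜ* GL (Fin n) B where
  toMonoidHom := Units.map (AlgHom.mapMatrix (m := Fin n) (φ : A →ₐ[ℂ] B) : _ →* _)
  continuous_toFun := Units.continuous_map (continuous_id.matrix_map φ.continuous)

/-- The homomorphism `K_{k+1}(A) → K_{k+1}(B)` induced by a Banach algebra morphism. -/
noncomputable def KSucc.map (φ : A →A[ℂ] B) (k : ℕ) : KSucc A k →* KSucc B k where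
  toFun := DirectLimit.map _ _ (fun n => PiGroup.map k (glMap φ n)) <| by
    intro i j h x
    obtain ⟨u, rfl⟩ := PiGroup.mk_surjective k x
    simp only [PiGroup.map_mk]
    congr 1
    ext y : 2
    have := pad_map (φ : A →+* B) h 1 (u.1 y).1
    rw [map_one] at this
    exact Units.ext this.symm
  map_one' := by
    rw [DirectLimit.one_def (0 : ℕ), DirectLimit.one_def (0 : ℕ), DirectLimit.map_def, map_one]
  map_mul' := by
    refine DirectLimit.induction₂ _ fun i x y => ?_
    rw [DirectLimit.mul_def, DirectLimit.map_def, DirectLimit.map_def, DirectLimit.map_def,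
      DirectLimit.mul_def, map_mul]

end KHigher

end BanachAlg

/-! Everything rests on one mechanism. Let `T : E → F` be a continuous linear map with dense range,
let `X` be dense in `E`, and let `U ⊆ E`, `V ⊆ F` be open with `T` mapping `U` into `V` and with `T
x ∈ V` forcing `x ∈ U` for `x ∈ X`. A continuous compact family in `V` can be approximated by images
of families in `X`, keeping prescribed boundary values; since `V` is open, the approximation is a
linear homotopy inside `V`, and the approximating family automatically lies in `U`. Applied to
points this gives surjectivity on path components, applied to paths injectivity, and applied to maps
of cubes relative to the boundary it gives bijectivity on homotopy groups. This is `exists_lift_rel`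
and its consequences `exists_joinedIn_map` and `joinedIn_of_joinedIn_map`.

For `K_{k+1}`, the open sets are the unit groups of `Mₙ(A)` and `Mₙ(B)`: equal spectra on `X` make
invertibility in the image imply invertibility (`bijective_piGroup_map`).

For `K₀`, idempotents are not open. They are replaced by the open set `almostIdem`, defined by a
spectral radius condition on a polynomial in `a`, hence detected on `X`. A functional calculus, the
binomial series for `(1 + z) ^ (-1/2)`, yields a continuous retraction `riesz` of this set onto the
idempotents, compatible with morphisms.

For the stable ranks, the open sets are the unimodular tuples. Orbits of the identity component of
`GLₘ` are path components of `Lg` (`joinedIn_Lg_iff`), so `csr` only sees path components of `Lg`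
and needs only the spectral condition for `n = 1`. For `gsr`, an invertible matrix over `B` must
also be lifted up to a path, which uses the condition on `Mₘ`. -/

namespace BanachAlg

/-! ### Approximate lifting of continuous families -/

section Lifting

variable {E F : Type*} [NormedAddCommGroup E] [NormedSpace ℝ E] [NormedAddCommGroup F]
  [NormedSpace ℝ F]

/-- Let `T : E → F` map the subspace `X` onto a dense subspace. A continuous family in an open set
`V ⊆ F` can be deformed, linearly and inside `V`, to the image of a family in `X`. The lift can be
prescribed where the family already is the image of a family in `X`. -/
theorem exists_lift_rel {K : Type*} [TopologicalSpace K] [CompactSpace K] [NormalSpace K]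
    [ParacompactSpace K] (T : E →L[ℝ] F) (X : Submodule ℝ E) (hX : Dense (T '' X)) {V : Set F}
    (hV : IsOpen V) (f : C(K, F)) (hf : ∀ x, f x ∈ V) (e : C(K, E)) (he : ∀ x, e x ∈ X) :
    ∃ h : C(K, E), (∀ x, h x ∈ X) ∧ (∀ x, f x = T (e x) → h x = e x) ∧
      ∀ x, segment ℝ (f x) (T (h x)) ⊆ V := by
  obtain ⟨δ, hδ, hδV⟩ := (isCompact_range f.continuous).exists_thickening_subset_open hV
    (Set.range_subset_iff.2 hf)
  -- The admissible values at each point form a convex set, and a fixed element of `X` stays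
  -- admissible nearby; a partition of unity glues these local constants.
  obtain ⟨g, hg⟩ := exists_continuous_forall_mem_convex_of_local_const
    (t := fun x => {v : E | v ∈ X ∧ T v ∈ Metric.ball (f x - T (e x)) (δ / 2)})
    (fun x => X.convex.inter ((convex_ball _ _).is_linear_preimage T.toLinearMap.isLinear))
    (fun x => by
      obtain ⟨_, hv, v, hvX, rfl⟩ := hX.inter_open_nonempty (Metric.ball (f x - T (e x)) (δ / 2))
        Metric.isOpen_ball ⟨_, Metric.mem_ball_self (half_pos hδ)⟩
      refine ⟨v, ?_⟩
      have hc : Continuous fun y => dist (T v) (f y - T (e y)) := by fun_prop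
      filter_upwards [hc.continuousAt.eventually_lt_const (Metric.mem_ball.1 hv)] with y hy
      exact ⟨hvX, hy⟩)
  -- The cutoff vanishes exactly where `f = T e`, which keeps the prescribed values, and equals 1
  -- once the discrepancy reaches `δ / 2`. Where it is below 1, the uncorrected discrepancy costs at
  -- most another `δ / 2`.
  let c : K → ℝ := fun x => min 1 (‖f x - T (e x)‖ / (δ / 2))
  have hc : Continuous c := by fun_prop
  have hc0 : ∀ x, 0 ≤ c x := fun x => le_min zero_le_one (by positivity)
  have hc1 : ∀ x, c x ≤ 1 := fun x => min_le_left _ _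
  refine ⟨⟨fun x => e x + c x • g x, by fun_prop⟩, fun x => ?_, fun x hx => ?_, fun x => ?_⟩
  · exact X.add_mem (he x) (X.smul_mem _ (hg x).1)
  · simp [c, hx]
  · refine subset_trans ?_ hδV
    have hb : Metric.ball (f x) δ ⊆ Metric.thickening δ (Set.range f) :=
      Metric.ball_subset_thickening (Set.mem_range_self x) δ
    refine ((convex_ball _ _).segment_subset (Metric.mem_ball_self hδ) ?_).trans hb
    have h1 : ‖T (g x) - (f x - T (e x))‖ < δ / 2 := by
      rw [← dist_eq_norm]; exact (hg x).2
    have h2 : (1 - c x) * ‖f x - T (e x)‖ ≤ δ / 2 := by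
      rcases le_total 1 (‖f x - T (e x)‖ / (δ / 2)) with h | h
      · simp only [c, min_eq_left h]; linarith
      · rw [div_le_one (half_pos hδ)] at h
        exact (mul_le_of_le_one_left (norm_nonneg _) (by linarith [hc0 x])).trans h
    have h3 : T (e x + c x • g x) - f x
        = c x • (T (g x) - (f x - T (e x))) - (1 - c x) • (f x - T (e x)) := by
      rw [map_add, map_smul]; module
    rw [Metric.mem_ball, dist_eq_norm]
    change ‖T (e x + c x • g x) - f x‖ < δ
    rw [h3]
    refine (norm_sub_le _ _).trans_lt ?_
    rw [norm_smul, norm_smul, Real.norm_of_nonneg (hc0 x), Real.norm_of_nonneg (by linarith [hc1 x])]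
    have h4 : c x * ‖T (g x) - (f x - T (e x))‖ ≤ ‖T (g x) - (f x - T (e x))‖ :=
      mul_le_of_le_one_left (norm_nonneg _) (hc1 x)
    linarith

variable {T : E →L[ℝ] F} {X : Submodule ℝ E} {U : Set E} {V : Set F}

lemma exists_joinedIn_of_dense (hX : Dense (X : Set E)) (hU : IsOpen U) {a : E} (ha : a ∈ U) :
    ∃ x ∈ X, JoinedIn U a x := by
  obtain ⟨δ, hδ, hb⟩ := Metric.isOpen_iff.1 hU a ha
  obtain ⟨x, hx, hxX⟩ := hX.inter_open_nonempty _ Metric.isOpen_ball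
    ⟨a, Metric.mem_ball_self hδ⟩
  exact ⟨x, hxX, JoinedIn.of_segment_subset
    (((convex_ball _ _).segment_subset (Metric.mem_ball_self hδ) hx).trans hb)⟩

/-- If `X` is dense and `T x ∈ V ↔ x ∈ U` on `X`, then every point of `V` is joined in `V` to the
image of a point of `U ∩ X`. -/
theorem exists_joinedIn_map (hX : Dense (X : Set E)) (hT : DenseRange T) (hV : IsOpen V)
    (hXU : ∀ x ∈ X, T x ∈ V → x ∈ U) {b : F} (hb : b ∈ V) :
    ∃ x ∈ X, x ∈ U ∧ JoinedIn V b (T x) := by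
  have hd : Dense ((X.map T.toLinearMap : Submodule ℝ F) : Set F) := hT.dense_image T.continuous hX
  obtain ⟨_, ⟨x, hx, rfl⟩, h⟩ := exists_joinedIn_of_dense hd hV hb
  exact ⟨x, hx, hXU x hx h.target_mem, h⟩

/-- If `X` is dense and `T x ∈ V ↔ x ∈ U` on `X`, then points of `U` are joined in `U` if their
images are joined in `V`. -/
theorem joinedIn_of_joinedIn_map (hX : Dense (X : Set E)) (hT : DenseRange T) (hU : IsOpen U)
    (hV : IsOpen V) (hUV : Set.MapsTo T U V) (hXU : ∀ x ∈ X, T x ∈ V → x ∈ U) {a b : E}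
    (ha : a ∈ U) (hb : b ∈ U) (h : JoinedIn V (T a) (T b)) : JoinedIn U a b := by
  obtain ⟨x, hx, hax⟩ := exists_joinedIn_of_dense hX hU ha
  obtain ⟨y, hy, hby⟩ := exists_joinedIn_of_dense hX hU hb
  have himg : ∀ {u v : E}, JoinedIn U u v → JoinedIn V (T u) (T v) := fun h =>
    (h.map T.continuous).mono hUV.image_subset
  have hxy : JoinedIn V (T x) (T y) := (himg hax).symm.trans (h.trans (himg hby))
  refine hax.trans (JoinedIn.trans ?_ hby.symm)
  obtain ⟨γ, hγ⟩ := hxy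
  -- The straight line from `x` to `y` may leave `U`; it only serves to prescribe the endpoints of
  -- the lift.
  obtain ⟨g, hgX, hge, hgV⟩ := exists_lift_rel T X (hT.dense_image T.continuous hX) hV
    (γ : C(unitInterval, F)) hγ
    ⟨fun t => (1 - (t : ℝ)) • x + (t : ℝ) • y, by fun_prop⟩
    (fun t => X.add_mem (X.smul_mem _ hx) (X.smul_mem _ hy))
  refine ⟨⟨g, ?_, ?_⟩, fun t => hXU _ (hgX t) (hgV t (right_mem_segment ℝ _ _))⟩
  · exact (hge 0 (by simp)).trans (by simp)
  · exact (hge 1 (by simp)).trans (by simp)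

end Lifting

/-! ### The inverse square root of `1 + z` for `z` of spectral radius less than one -/

section InvSqrt

/-- The elements with a power of norm less than one, that is those of spectral radius less than
one. -/
def powContractive (R : Type*) [NormedRing R] : Set R := {z | ∃ m, 0 < m ∧ ‖z ^ m‖ < 1}

variable {R S : Type*} [NormedRing R] [NormedRing S]

lemma isOpen_powContractive : IsOpen (powContractive R) := by
  have : powContractive R = ⋃ m : ℕ, ⋃ _ : 0 < m, {z : R | ‖z ^ m‖ < 1} := by
    ext z; simp [powContractive]
  rw [this]
  exact isOpen_iUnion fun m => isOpen_iUnion fun _ => isOpen_lt (by fun_prop) continuous_const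

/-- Near an element of `powContractive R` the powers decay geometrically, uniformly. -/
lemma exists_summable_bound_pow {w : R} (hw : w ∈ powContractive R) :
    ∃ U ∈ 𝓝 w, ∃ u : ℕ → ℝ, Summable u ∧ ∀ k, ∀ z ∈ U, ‖z ^ k‖ ≤ u k := by
  obtain ⟨m, hm, hlt⟩ := hw
  obtain ⟨q, hwq, hq1⟩ := exists_between hlt
  have hq0 : 0 < q := (norm_nonneg _).trans_lt hwq
  -- The decay rate is the `m`-th root of `q`; the finitely many residual powers `z ^ (k % m)` are
  -- absorbed in the constant `C`.
  set ρ : ℝ := q ^ ((m : ℝ)⁻¹) with hρ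
  have hρ0 : 0 < ρ := Real.rpow_pos_of_pos hq0 _
  have hρ1 : ρ < 1 := Real.rpow_lt_one hq0.le hq1 (by positivity)
  have hρm : ρ ^ m = q := Real.rpow_inv_natCast_pow hq0.le hm.ne'
  have hU1 : {z : R | ‖z ^ m‖ < q} ∈ 𝓝 w :=
    (isOpen_lt (by fun_prop) continuous_const).mem_nhds hwq
  have hU2 : {z : R | ∀ j ∈ Finset.range m, ‖z ^ j‖ < ‖w ^ j‖ + 1} ∈ 𝓝 w := by
    refine (Filter.eventually_all_finset (Finset.range m)).2 fun j _ => ?_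
    exact (isOpen_lt (by fun_prop) continuous_const).mem_nhds (lt_add_one ‖w ^ j‖)
  set C : ℝ := ∑ j ∈ Finset.range m, (‖w ^ j‖ + 1)
  refine ⟨_, Filter.inter_mem hU1 hU2, fun k => C / q * ρ ^ k,
    (summable_geometric_of_lt_one hρ0.le hρ1).mul_left _, fun k z hz => ?_⟩
  have h1 : ∀ (v : R) (t : ℕ), ‖v * (z ^ m) ^ t‖ ≤ ‖v‖ * q ^ t := by
    intro v t
    induction t with
    | zero => simp
    | succ t ih =>
      rw [pow_succ, ← mul_assoc, pow_succ, ← mul_assoc]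
      exact (norm_mul_le _ _).trans (mul_le_mul ih hz.1.le (norm_nonneg _) (by positivity))
  have hlt := Nat.mod_lt k hm
  have h2 : ‖z ^ (k % m)‖ ≤ C :=
    (hz.2 _ (Finset.mem_range.2 hlt)).le.trans
      (Finset.single_le_sum (f := fun j => ‖w ^ j‖ + 1) (fun j _ => by positivity)
        (Finset.mem_range.2 hlt))
  have hk := Nat.mod_add_div k m
  have h3 : q ^ (k / m) * q ≤ ρ ^ k := by
    rw [← hρm, ← pow_mul, ← pow_add]
    exact pow_le_pow_of_le_one hρ0.le hρ1.le (by omega)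
  calc ‖z ^ k‖ = ‖z ^ (k % m) * (z ^ m) ^ (k / m)‖ := by rw [← pow_mul, ← pow_add, hk]
    _ ≤ ‖z ^ (k % m)‖ * q ^ (k / m) := h1 _ _
    _ ≤ C * (ρ ^ k / q) := mul_le_mul h2 ((le_div_iff₀ hq0).2 h3) (by positivity)
        ((norm_nonneg _).trans h2)
    _ = C / q * ρ ^ k := by ring

lemma summable_norm_pow {z : R} (hz : z ∈ powContractive R) : Summable fun k => ‖z ^ k‖ := by
  obtain ⟨U, hU, u, hu, hb⟩ := exists_summable_bound_pow hz
  exact Summable.of_nonneg_of_le (fun _ => norm_nonneg _) (fun k => hb k z (mem_of_mem_nhds hU)) hu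

/-- Consecutive coefficients have ratio `(-1/2 - k) / (k + 1)`, of modulus at most 1. -/
lemma norm_choose_neg_half_le (k : ℕ) : ‖Ring.choose (-1 / 2 : ℂ) k‖ ≤ 1 := by
  induction k with
  | zero => simp
  | succ k ih =>
    have h : Ring.choose (-1 / 2 : ℂ) (k + 1) =
        Ring.choose (-1 / 2 : ℂ) k * ((-1 / 2 - k) / (k + 1)) := by
      rw [Ring.choose_eq_smul, Ring.choose_eq_smul, descPochhammer_succ_right,
        Polynomial.smeval_mul, Nat.factorial_succ]
      simp [Polynomial.smeval_sub, Polynomial.smeval_natCast]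
      field_simp
    have h2 : ‖(-1 / 2 - k : ℂ) / (k + 1)‖ ≤ 1 := by
      have e1 : (-1 / 2 - k : ℂ) = ((-(1 / 2 + k : ℝ) : ℝ) : ℂ) := by push_cast; ring
      have e2 : (k + 1 : ℂ) = ((k + 1 : ℝ) : ℂ) := by push_cast; ring
      rw [norm_div, e1, e2, Complex.norm_real, Complex.norm_real, norm_neg,
        Real.norm_of_nonneg (by positivity), Real.norm_of_nonneg (by positivity)]
      exact div_le_one_of_le₀ (by linarith) (by positivity)
    rw [h, norm_mul]
    exact mul_le_one₀ ih (norm_nonneg _) h2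

/-- Vandermonde's identity reduces the sum to the binomial coefficient of `-1`. -/
lemma sum_antidiagonal_choose_neg_half (k : ℕ) :
    ∑ ij ∈ Finset.HasAntidiagonal.antidiagonal k, Ring.choose (-1 / 2 : ℂ) ij.1 * Ring.choose (-1 / 2 : ℂ) ij.2
      = (-1) ^ k := by
  rw [← Ring.add_choose_eq k (Commute.all _ _)]
  have h : (-1 / 2 + -1 / 2 : ℂ) = -1 := by norm_num
  rw [h, Ring.choose_neg, add_sub_cancel_left, Ring.choose_natCast, Nat.choose_self]
  rcases Nat.even_or_odd k with hk | hk
  · rw [Int.negOnePow_even _ (by exact_mod_cast hk), hk.neg_one_pow]; simp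
  · rw [Int.negOnePow_odd _ (by exact_mod_cast hk), hk.neg_one_pow]; simp

variable [NormedAlgebra ℂ R] [NormedAlgebra ℂ S]

/-- The binomial series of `(1 + z) ^ (-1/2)`. -/
noncomputable def invSqrt (z : R) : R := ∑' k, Ring.choose (-1 / 2 : ℂ) k • z ^ k

lemma norm_invSqrt_term_le (z : R) (k : ℕ) :
    ‖Ring.choose (-1 / 2 : ℂ) k • z ^ k‖ ≤ ‖z ^ k‖ := by
  rw [norm_smul]
  exact mul_le_of_le_one_left (norm_nonneg _) (norm_choose_neg_half_le k)

lemma summable_norm_invSqrt {z : R} (hz : z ∈ powContractive R) :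
    Summable fun k => ‖Ring.choose (-1 / 2 : ℂ) k • z ^ k‖ :=
  Summable.of_nonneg_of_le (fun _ => norm_nonneg _) (norm_invSqrt_term_le z) (summable_norm_pow hz)

lemma commute_invSqrt {a z : R} (h : Commute a z) : Commute a (invSqrt z) :=
  Commute.tsum_right a fun k => (h.pow_right k).smul_right _

lemma invSqrt_zero : invSqrt (0 : R) = 1 := by
  rw [invSqrt, tsum_eq_single 0]
  · simp
  · intro k hk
    simp [hk]

variable [CompleteSpace R]

lemma map_invSqrt (f : R →A[ℂ] S) {z : R} (hz : z ∈ powContractive R) :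
    f (invSqrt z) = invSqrt (f z) := by
  have := (summable_norm_invSqrt hz).of_norm.map_tsum f f.continuous
  simpa [invSqrt] using this

lemma continuousOn_invSqrt : ContinuousOn (invSqrt : R → R) (powContractive R) := by
  intro w hw
  obtain ⟨U, hU, u, hu, hb⟩ := exists_summable_bound_pow hw
  have : ContinuousOn (invSqrt : R → R) U :=
    continuousOn_tsum (fun k => by fun_prop) hu
      fun k z hz => (norm_invSqrt_term_le z k).trans (hb k z hz)
  exact (this.continuousAt hU).continuousWithinAt

/-- The Cauchy square of the binomial series is the geometric series of `-z`. -/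
lemma one_add_mul_invSqrt_mul_self {z : R} (hz : z ∈ powContractive R) :
    (1 + z) * (invSqrt z * invSqrt z) = 1 := by
  have hs := summable_norm_invSqrt hz
  have h1 : invSqrt z * invSqrt z = ∑' k, (-z) ^ k := by
    rw [invSqrt, tsum_mul_tsum_eq_tsum_sum_antidiagonal_of_summable_norm hs hs]
    refine tsum_congr fun k => ?_
    calc _ = ∑ ij ∈ Finset.HasAntidiagonal.antidiagonal k,
          (Ring.choose (-1 / 2 : ℂ) ij.1 * Ring.choose (-1 / 2 : ℂ) ij.2) • z ^ k := by
          refine Finset.sum_congr rfl fun ij hij => ?_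
          rw [smul_mul_smul_comm, ← pow_add, Finset.HasAntidiagonal.mem_antidiagonal.1 hij]
      _ = (-z) ^ k := by
          rw [← Finset.sum_smul, sum_antidiagonal_choose_neg_half, neg_pow z]
          rcases neg_one_pow_eq_or ℂ k with h | h <;> rcases Nat.even_or_odd k with hk | hk <;>
            simp [hk.neg_one_pow]
  have hs' : Summable fun k => (-z) ^ k := by
    refine Summable.of_norm ((summable_norm_pow hz).congr fun k => ?_)
    rcases Nat.even_or_odd k with hk | hk <;> simp [hk.neg_pow]
  rw [h1, ← sub_neg_eq_add 1 z, hs'.one_sub_mul_tsum_pow]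

end InvSqrt

/-! ### Morphisms preserving spectra on a dense subalgebra -/

section Spectral

variable {R S : Type*} [NormedRing R] [NormedAlgebra ℂ R] [NormedRing S] [NormedAlgebra ℂ S]

/-- A morphism need not be norm-decreasing, so a further power is taken: the powers of `z ^ m` tend
to 0, and so do their images. -/
lemma map_mem_powContractive (f : R →A[ℂ] S) {z : R} (hz : z ∈ powContractive R) :
    f z ∈ powContractive S := by
  obtain ⟨m, hm, hlt⟩ := hz
  have h := ((f.continuous.tendsto 0).comp (tendsto_pow_atTop_nhds_zero_of_norm_lt_one hlt)).norm
  rw [map_zero, norm_zero] at h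
  obtain ⟨k, hk, hk0⟩ := ((h.eventually_lt_const zero_lt_one).and
    (Filter.eventually_gt_atTop 0)).exists
  exact ⟨m * k, Nat.mul_pos hm hk0, by simpa [pow_mul] using hk⟩

variable {f : R →A[ℂ] S} {X : Subalgebra ℂ R}

lemma isUnit_of_isUnit_map (hX : ∀ x ∈ X, spectrum ℂ (f x) = spectrum ℂ x) {x : R} (hx : x ∈ X)
    (h : IsUnit (f x)) : IsUnit x := by
  rw [← spectrum.zero_notMem_iff ℂ] at h ⊢
  rwa [← hX x hx]

variable [CompleteSpace R] [CompleteSpace S]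

/-- By the Neumann series the spectrum of `f x ^ m` lies in the open unit disc. It is also the
spectrum of `x ^ m`, as `x ^ m ∈ X`, and Gelfand's formula gives a power of norm less than one. -/
lemma mem_powContractive_of_map (hX : ∀ x ∈ X, spectrum ℂ (f x) = spectrum ℂ x) {x : R}
    (hx : x ∈ X) (h : f x ∈ powContractive S) : x ∈ powContractive R := by
  rcases subsingleton_or_nontrivial R with hR | hR
  · exact ⟨1, one_pos, by simp [Subsingleton.elim x 0]⟩
  obtain ⟨m, hm, hlt⟩ := h
  have hr : spectralRadius ℂ (x ^ m) < (1 : NNReal) := by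
    refine spectrum.spectralRadius_lt_of_forall_lt _ fun l hl => ?_
    by_contra! hl1
    rw [← hX _ (pow_mem hx m), map_pow, spectrum.mem_iff] at hl
    have hl1' : 1 ≤ ‖l‖ := hl1
    have hl0 : l ≠ 0 := norm_pos_iff.1 (one_pos.trans_le hl1')
    apply hl
    have hu : IsUnit (1 - l⁻¹ • f x ^ m) := by
      apply isUnit_one_sub_of_norm_lt_one
      rw [norm_smul, norm_inv]
      exact (mul_le_of_le_one_left (norm_nonneg _) (inv_le_one_of_one_le₀ hl1')).trans_lt hlt
    have := (hu.smul (Units.mk0 l hl0))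
    rwa [Units.smul_def, Units.val_mk0, smul_sub, smul_smul, mul_inv_cancel₀ hl0, one_smul,
      ← Algebra.algebraMap_eq_smul_one] at this
  obtain ⟨k, hk, hk0⟩ := (((spectrum.pow_nnnorm_pow_one_div_tendsto_nhds_spectralRadius
    (x ^ m)).eventually_lt_const hr).and (Filter.eventually_gt_atTop 0)).exists
  refine ⟨m * k, Nat.mul_pos hm hk0, ?_⟩
  rw [pow_mul]
  by_contra! h1
  refine hk.not_ge ?_
  have h1' : (1 : ENNReal) ≤ ‖(x ^ m) ^ k‖₊ := by exact_mod_cast h1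
  exact ENNReal.one_le_rpow h1' (by positivity)

end Spectral

/-! ### Idempotents close to a given element -/

section Riesz

variable {R S : Type*} [NormedRing R] [NormedRing S]

/-- The elements `a` such that `(2 a - 1)² - 1` has spectral radius less than one. -/
def almostIdem (R : Type*) [NormedRing R] : Set R :=
  {a | (2 * a - 1) * (2 * a - 1) - 1 ∈ powContractive R}

lemma isOpen_almostIdem : IsOpen (almostIdem R) :=
  isOpen_powContractive.preimage (by fun_prop)

lemma two_mul_sub_one_mul_self {p : R} (hp : IsIdempotentElem p) :
    (2 * p - 1) * (2 * p - 1) = 1 := by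
  have h : (2 * p - 1) * (2 * p - 1) = 4 * (p * p) - 4 * p + 1 := by noncomm_ring
  rw [h, hp.eq, sub_self, zero_add]

lemma mem_almostIdem {p : R} (hp : IsIdempotentElem p) : p ∈ almostIdem R :=
  ⟨1, one_pos, by simp [two_mul_sub_one_mul_self hp]⟩

variable [NormedAlgebra ℂ R] [NormedAlgebra ℂ S]

lemma map_mem_almostIdem (f : R →A[ℂ] S) {a : R} (ha : a ∈ almostIdem R) :
    f a ∈ almostIdem S := by
  simpa [almostIdem, map_ofNat f 2] using map_mem_powContractive f ha

/-- The Riesz idempotent of `a`, for the part of the spectrum with real part greater than `1/2`: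
`(1 + u) / 2` where `u = (2 a - 1) ((2 a - 1)²) ^ (-1/2)`. -/
noncomputable def riesz (a : R) : R :=
  (1 / 2 : ℂ) • (1 + (2 * a - 1) * invSqrt ((2 * a - 1) * (2 * a - 1) - 1))

lemma riesz_of_isIdempotentElem {p : R} (hp : IsIdempotentElem p) : riesz p = p := by
  rw [riesz, two_mul_sub_one_mul_self hp, sub_self, invSqrt_zero, mul_one, add_sub_cancel,
    two_mul, ← two_smul ℂ, smul_smul]
  norm_num

variable [CompleteSpace R]

/-- With `b = 2 a - 1`, the element `u = b (b²) ^ (-1/2)` satisfies `u² = 1` because its two factors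
commute. -/
lemma isIdempotentElem_riesz {a : R} (ha : a ∈ almostIdem R) : IsIdempotentElem (riesz a) := by
  set b := 2 * a - 1 with hb
  have hc : Commute b (invSqrt (b * b - 1)) :=
    commute_invSqrt (((Commute.refl b).mul_right (Commute.refl b)).sub_right (Commute.one_right b))
  set u := b * invSqrt (b * b - 1) with hu
  have hu2 : u * u = 1 := by
    have := one_add_mul_invSqrt_mul_self (z := b * b - 1) ha
    rw [add_sub_cancel] at this
    rw [hu, hc.symm.mul_mul_mul_comm, this]
  change (1 / 2 : ℂ) • (1 + u) * (1 / 2 : ℂ) • (1 + u) = (1 / 2 : ℂ) • (1 + u)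
  rw [smul_mul_smul_comm]
  have : (1 + u) * (1 + u) = (2 : ℂ) • (1 + u) := by
    rw [two_smul, mul_add, add_mul, add_mul, hu2]; simp only [one_mul, mul_one]; abel
  rw [this, smul_smul]; norm_num

lemma continuousOn_riesz : ContinuousOn (riesz : R → R) (almostIdem R) := by
  have h : ContinuousOn (fun a : R => invSqrt ((2 * a - 1) * (2 * a - 1) - 1)) (almostIdem R) :=
    continuousOn_invSqrt.comp (by fun_prop) fun a ha => ha
  exact (continuousOn_const.add ((by fun_prop : ContinuousOn (fun a : R => 2 * a - 1) _).mul
    h)).const_smul _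

lemma map_riesz (f : R →A[ℂ] S) {a : R} (ha : a ∈ almostIdem R) :
    f (riesz a) = riesz (f a) := by
  rw [riesz, map_smul, map_add, map_one, map_mul, map_invSqrt f ha]
  simp [riesz, map_ofNat f 2]

lemma joined_riesz {a b : R} (h : JoinedIn (almostIdem R) a b) :
    Joined (⟨riesz a, isIdempotentElem_riesz h.source_mem⟩ : {p : R // IsIdempotentElem p})
      ⟨riesz b, isIdempotentElem_riesz h.target_mem⟩ := by
  obtain ⟨γ, hγ⟩ := h
  refine ⟨⟨⟨fun t => ⟨riesz (γ t), isIdempotentElem_riesz (hγ t)⟩, ?_⟩, ?_, ?_⟩⟩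
  · exact (continuousOn_riesz.comp_continuous γ.continuous hγ).subtype_mk _
  · simp
  · simp

/-- A path in the open set is pushed to a path of idempotents by the retraction `riesz`, which fixes
its endpoints. -/
lemma joined_iff_joinedIn_almostIdem {p q : {p : R // IsIdempotentElem p}} :
    Joined p q ↔ JoinedIn (almostIdem R) p.1 q.1 := by
  refine ⟨fun h => ⟨h.somePath.map continuous_subtype_val, fun t =>
    mem_almostIdem (h.somePath t).2⟩, fun h => ?_⟩
  have := joined_riesz h
  simpa only [riesz_of_isIdempotentElem p.2, riesz_of_isIdempotentElem q.2] using this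

variable [CompleteSpace S] {f : R →A[ℂ] S} {X : Subalgebra ℂ R}

lemma mem_almostIdem_of_map (hX : ∀ x ∈ X, spectrum ℂ (f x) = spectrum ℂ x) {x : R} (hx : x ∈ X)
    (h : f x ∈ almostIdem S) : x ∈ almostIdem R := by
  have h2 : (2 : R) * x - 1 ∈ X := by
    rw [two_mul]; exact X.sub_mem (X.add_mem hx hx) X.one_mem
  refine mem_powContractive_of_map hX (X.sub_mem (X.mul_mem h2 h2) X.one_mem) ?_
  simpa [almostIdem, map_ofNat f 2] using h

/-- The map on path components of the spaces of idempotents is injective. -/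
theorem joined_of_joined_map (hXd : Dense (X : Set R)) (hf : DenseRange f)
    (hX : ∀ x ∈ X, spectrum ℂ (f x) = spectrum ℂ x) {p q : {p : R // IsIdempotentElem p}}
    {p' q' : {p : S // IsIdempotentElem p}} (hp : p'.1 = f p.1) (hq : q'.1 = f q.1)
    (h : Joined p' q') : Joined p q := by
  rw [joined_iff_joinedIn_almostIdem] at h ⊢
  rw [hp, hq] at h
  exact joinedIn_of_joinedIn_map (T := f.toContinuousLinearMap.restrictScalars ℝ)
    (X := X.toSubmodule.restrictScalars ℝ) hXd hf isOpen_almostIdem isOpen_almostIdem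
    (fun a ha => map_mem_almostIdem f ha) (fun x hx => mem_almostIdem_of_map hX hx)
    (mem_almostIdem p.2) (mem_almostIdem q.2) h

/-- The map on path components of the spaces of idempotents is surjective. -/
theorem exists_joined_map (hXd : Dense (X : Set R)) (hf : DenseRange f)
    (hX : ∀ x ∈ X, spectrum ℂ (f x) = spectrum ℂ x) (q : {p : S // IsIdempotentElem p}) :
    ∃ p : {p : R // IsIdempotentElem p}, ∀ p' : {p : S // IsIdempotentElem p}, p'.1 = f p.1 →
      Joined q p' := by
  obtain ⟨x, -, hxU, hj⟩ := exists_joinedIn_map (T := f.toContinuousLinearMap.restrictScalars ℝ)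
    (X := X.toSubmodule.restrictScalars ℝ) (U := almostIdem R) hXd hf isOpen_almostIdem
    (fun x hx => mem_almostIdem_of_map hX hx) (mem_almostIdem q.2)
  refine ⟨⟨riesz x, isIdempotentElem_riesz hxU⟩, fun p' hp' => ?_⟩
  have h := joined_riesz hj
  simp only [riesz_of_isIdempotentElem q.2] at h
  convert h using 1
  exact Subtype.ext (hp'.trans (map_riesz f hxU))

end Riesz

/-! ### Homotopy groups of the groups of units -/

section Units

variable {R S : Type*} [NormedRing R] [CompleteSpace R] [NormedRing S] [CompleteSpace S]
  {K : Type*} [TopologicalSpace K]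

/-- The units of a complete normed ring carry the subspace topology, so families of units can be
built and deformed in the ambient ring. -/
lemma exists_continuousMap_units (h : C(K, R)) (hu : ∀ x, IsUnit (h x)) :
    ∃ u : C(K, Rˣ), ∀ x, (u x : R) = h x := by
  choose u hu using hu
  exact ⟨⟨u, Units.isOpenEmbedding_val.isInducing.continuous_iff.2
    (h.continuous.congr fun x => (hu x).symm)⟩, hu⟩

lemma homotopicRel_of_forall_isUnit {s : Set K} {u v : C(K, Rˣ)} (H : C(unitInterval × K, R))
    (hH : ∀ x, IsUnit (H x)) (h0 : ∀ x, H (0, x) = u x) (h1 : ∀ x, H (1, x) = v x)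
    (hs : ∀ t, ∀ x ∈ s, H (t, x) = u x) : u.HomotopicRel v s := by
  obtain ⟨G, hG⟩ := exists_continuousMap_units H hH
  exact ⟨⟨⟨G, fun x => Units.ext ((hG _).trans (h0 x)), fun x => Units.ext ((hG _).trans (h1 x))⟩,
    fun t x hx => Units.ext ((hG _).trans (hs t x hx))⟩⟩

variable [NormedAlgebra ℂ R] [NormedAlgebra ℂ S]

lemma homotopicRel_of_segment {s : Set K} {u v : C(K, Rˣ)}
    (h : ∀ x, segment ℝ (u x : R) (v x) ⊆ {a | IsUnit a}) (hs : ∀ x ∈ s, u x = v x) :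
    u.HomotopicRel v s := by
  have hu : Continuous fun x => (u x : R) := Units.continuous_val.comp u.continuous
  have hv : Continuous fun x => (v x : R) := Units.continuous_val.comp v.continuous
  refine homotopicRel_of_forall_isUnit
    ⟨fun p => (1 - (p.1 : ℝ)) • (u p.2 : R) + (p.1 : ℝ) • (v p.2 : R), by fun_prop⟩
    (fun p => h p.2 ⟨1 - p.1, p.1, by linarith [p.1.2.2], p.1.2.1, by ring, rfl⟩)
    (fun x => by simp) (fun x => by simp) (fun t x hx => ?_)
  simp [hs x hx, ← add_smul]

variable [CompactSpace K] [T2Space K] {f : R →A[ℂ] S} {X : Subalgebra ℂ R} {s : Set K}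

/-- Maps to the group of units can be deformed to `X`-valued maps. -/
lemma exists_homotopicRel_mem (hXd : Dense (X : Set R)) (u : C(K, Rˣ)) (hu : ∀ x ∈ s, u x = 1) :
    ∃ v : C(K, Rˣ), (∀ x, (v x : R) ∈ X) ∧ (∀ x ∈ s, v x = 1) ∧ u.HomotopicRel v s := by
  obtain ⟨h, hX, he, hV⟩ := exists_lift_rel (ContinuousLinearMap.id ℝ R)
    (X.toSubmodule.restrictScalars ℝ) (by simpa using hXd) Units.isOpen
    ⟨fun x => (u x : R), Units.continuous_val.comp u.continuous⟩ (fun x => (u x).isUnit) 1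
    (fun _ => X.one_mem)
  obtain ⟨v, hv⟩ := exists_continuousMap_units h fun x => hV x (right_mem_segment ℝ _ _)
  have hv1 : ∀ x ∈ s, v x = 1 := fun x hx =>
    Units.ext ((hv x).trans (he x (congrArg Units.val (hu x hx))))
  refine ⟨v, fun x => (hv x) ▸ hX x, hv1, homotopicRel_of_segment (fun x => ?_)
    fun x hx => (hu x hx).trans (hv1 x hx).symm⟩
  rw [hv]; exact hV x

variable (hXd : Dense (X : Set R)) (hf : DenseRange f)
  (hX : ∀ x ∈ X, spectrum ℂ (f x) = spectrum ℂ x) {g : Rˣ →ₜ* Sˣ} (hg : ∀ u, (g u : S) = f u)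

include hXd hf hX hg

/-- Surjectivity on homotopy classes: the lift is prescribed to be 1 wherever `u` is 1. -/
lemma exists_homotopicRel_comp (u : C(K, Sˣ)) (hu : ∀ x ∈ s, u x = 1) :
    ∃ v : C(K, Rˣ), (∀ x ∈ s, v x = 1) ∧ u.HomotopicRel ((g : C(Rˣ, Sˣ)).comp v) s := by
  obtain ⟨h, hhX, he, hV⟩ := exists_lift_rel (f.toContinuousLinearMap.restrictScalars ℝ)
    (X.toSubmodule.restrictScalars ℝ) (hf.dense_image f.continuous hXd) Units.isOpen
    ⟨fun x => (u x : S), Units.continuous_val.comp u.continuous⟩ (fun x => (u x).isUnit) 1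
    (fun _ => X.one_mem)
  obtain ⟨v, hv⟩ := exists_continuousMap_units h fun x =>
    isUnit_of_isUnit_map hX (hhX x) (hV x (right_mem_segment ℝ _ _))
  have hv1 : ∀ x ∈ s, v x = 1 := fun x hx =>
    Units.ext ((hv x).trans (he x ((congrArg Units.val (hu x hx)).trans (map_one f).symm)))
  refine ⟨v, hv1, homotopicRel_of_segment (fun x => ?_)
    fun x hx => (hu x hx).trans ?_⟩
  · change segment ℝ (u x : S) (g (v x)) ⊆ _
    rw [hg, hv]; exact hV x
  · change 1 = g (v x)
    rw [hv1 x hx, map_one]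

/-- Injectivity on homotopy classes: once both ends are `X`-valued, the homotopy downstairs is
lifted relative to its ends and to `s`. -/
lemma homotopicRel_of_comp {u v : C(K, Rˣ)} (hu : ∀ x ∈ s, u x = 1) (hv : ∀ x ∈ s, v x = 1)
    (h : ((g : C(Rˣ, Sˣ)).comp u).HomotopicRel ((g : C(Rˣ, Sˣ)).comp v) s) :
    u.HomotopicRel v s := by
  obtain ⟨u', hu'X, hu', huu'⟩ := exists_homotopicRel_mem hXd u hu
  obtain ⟨v', hv'X, hv', hvv'⟩ := exists_homotopicRel_mem hXd v hv
  refine huu'.trans (ContinuousMap.HomotopicRel.trans ?_ hvv'.symm)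
  obtain ⟨H⟩ := ((huu'.symm.comp_continuousMap (g : C(Rˣ, Sˣ))).trans h).trans
    (hvv'.comp_continuousMap (g : C(Rˣ, Sˣ)))
  have hcu : Continuous fun x => (u' x : R) := Units.continuous_val.comp u'.continuous
  have hcv : Continuous fun x => (v' x : R) := Units.continuous_val.comp v'.continuous
  -- The values of `e` need not be invertible; only those at times 0 and 1 and over `s`, where it
  -- matches `H`, are kept.
  let e : C(unitInterval × K, R) :=
    ⟨fun p => (1 - (p.1 : ℝ)) • (u' p.2 : R) + (p.1 : ℝ) • (v' p.2 : R), by fun_prop⟩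
  have e0 : ∀ x, e (0, x) = u' x := fun x => by simp [e]
  have e1 : ∀ x, e (1, x) = v' x := fun x => by simp [e]
  have es : ∀ t, ∀ x ∈ s, e (t, x) = 1 := fun t x hx => by
    simp [e, hu' x hx, hv' x hx, ← add_smul]
  obtain ⟨k, hkX, hke, hkV⟩ := exists_lift_rel (f.toContinuousLinearMap.restrictScalars ℝ)
    (X.toSubmodule.restrictScalars ℝ) (hf.dense_image f.continuous hXd) Units.isOpen
    ⟨fun p => (H p : S), Units.continuous_val.comp H.continuous⟩ (fun p => (H p).isUnit) e
    (fun p => Submodule.add_mem _ (Submodule.smul_mem _ _ (hu'X p.2))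
      (Submodule.smul_mem _ _ (hv'X p.2)))
  refine homotopicRel_of_forall_isUnit k (fun p => isUnit_of_isUnit_map hX (hkX p)
    (hkV p (right_mem_segment ℝ _ _))) (fun x => (hke _ ?_).trans (e0 x))
    (fun x => (hke _ ?_).trans (e1 x)) (fun t x hx => (hke _ ?_).trans ?_)
  · change (H (0, x) : S) = f (e (0, x))
    rw [H.apply_zero, e0, ← hg]; rfl
  · change (H (1, x) : S) = f (e (1, x))
    rw [H.apply_one, e1, ← hg]; rfl
  · change (H (t, x) : S) = f (e (t, x))
    rw [es t x hx, H.eq_fst t hx]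
    change (g (u' x) : S) = _
    rw [hu' x hx, map_one, map_one, Units.val_one]
  · rw [es t x hx, hu' x hx, Units.val_one]

/-- A morphism with dense range which preserves the spectra on a dense subalgebra induces
isomorphisms of the homotopy groups of the groups of units. -/
theorem bijective_piGroup_map (k : ℕ) : Function.Bijective (PiGroup.map k g) := by
  constructor
  · intro a b hab
    obtain ⟨u, rfl⟩ := PiGroup.mk_surjective k a
    obtain ⟨v, rfl⟩ := PiGroup.mk_surjective k b
    rw [PiGroup.map_mk, PiGroup.map_mk] at hab
    exact (Con.eq (loopCon k Rˣ)).2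
      (homotopicRel_of_comp hXd hf hX hg u.2 v.2 ((Con.eq (loopCon k Sˣ)).1 hab))
  · intro b
    obtain ⟨u, rfl⟩ := PiGroup.mk_surjective k b
    obtain ⟨v, hv, h⟩ := exists_homotopicRel_comp hXd hf hX hg u.1 u.2
    exact ⟨PiGroup.mk k ⟨v, hv⟩, ((Con.eq (loopCon k Sˣ)).2 h).symm⟩

end Units

/-! ### The Banach algebra of square matrices -/

section MatrixNorm

/-- A Banach algebra norm on square matrices, whose uniform structure is by definition the
entrywise one. -/
@[reducible]
noncomputable def matrixNormedRing (A : Type*) [NormedRing A] (n : ℕ) :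
    NormedRing (Matrix (Fin n) (Fin n) A) where
  toNorm := (Matrix.linftyOpNormedRing (n := Fin n) (α := A)).toNorm
  toRing := Matrix.instRing
  toMetricSpace := (Matrix.linftyOpNormedRing (n := Fin n) (α := A)).toMetricSpace.replaceUniformity
    (U := Matrix.instUniformSpace _ _ _) rfl
  dist_eq := (Matrix.linftyOpNormedRing (n := Fin n) (α := A)).dist_eq
  norm_mul_le := (Matrix.linftyOpNormedRing (n := Fin n) (α := A)).norm_mul_le

attribute [local instance] matrixNormedRing

/-- The norm of `matrixNormedRing` is an algebra norm. -/
@[reducible]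
noncomputable def matrixNormedAlgebra (A : Type*) [NormedRing A] [NormedAlgebra ℂ A] (n : ℕ) :
    NormedAlgebra ℂ (Matrix (Fin n) (Fin n) A) where
  toAlgebra := Matrix.instAlgebra
  norm_smul_le := (Matrix.linftyOpNormedAlgebra (n := Fin n) (α := A) (R := ℂ)).norm_smul_le

lemma completeSpace_matrix (A : Type*) [NormedRing A] [CompleteSpace A] (n : ℕ) :
    CompleteSpace (Matrix (Fin n) (Fin n) A) :=
  inferInstanceAs (CompleteSpace (Fin n → Fin n → A))

end MatrixNorm

/-! ### Amplification of morphisms to matrices -/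

section MatrixMap

attribute [local instance] matrixNormedRing matrixNormedAlgebra completeSpace_matrix

variable {A B : Type*} [NormedRing A] [NormedAlgebra ℂ A] [NormedRing B] [NormedAlgebra ℂ B]

/-- The amplification `Mₙ(A) → Mₙ(B)` of a Banach algebra morphism. -/
def matrixMap (φ : A →A[ℂ] B) (n : ℕ) :
    Matrix (Fin n) (Fin n) A →A[ℂ] Matrix (Fin n) (Fin n) B where
  toAlgHom := AlgHom.mapMatrix (m := Fin n) (φ : A →ₐ[ℂ] B)
  cont := continuous_id.matrix_map φ.continuous

lemma denseRange_matrixMap {φ : A →A[ℂ] B} (hφ : DenseRange φ) (n : ℕ) :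
    DenseRange (matrixMap φ n) :=
  DenseRange.piMap fun _ => DenseRange.piMap fun _ => hφ

lemma exists_dense_subalgebra {φ : A →A[ℂ] B} (h : IsCompletelyRelativelySpectral φ) (n : ℕ) :
    ∃ X : Subalgebra ℂ (Matrix (Fin n) (Fin n) A), Dense (X : Set (Matrix (Fin n) (Fin n) A)) ∧
      ∀ x ∈ X, spectrum ℂ (matrixMap φ n x) = spectrum ℂ x := by
  -- The limits start at size 0, where the hypothesis is silent but the matrix rings are zero and
  -- all spectra are empty.
  rcases n.eq_zero_or_pos with rfl | hn
  · refine ⟨⊤, by simp, fun x _ => ?_⟩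
    rw [spectrum.of_subsingleton, spectrum.of_subsingleton]
  · exact h n hn

/-- A matrix of size one is its entry. -/
def oneByOneEquiv (A : Type*) [NormedRing A] [NormedAlgebra ℂ A] :
    Matrix (Fin 1) (Fin 1) A ≃ₐ[ℂ] A where
  toFun M := M 0 0
  invFun a := Matrix.of fun _ _ => a
  left_inv M := by ext i j; simp [Subsingleton.elim i 0, Subsingleton.elim j 0]
  right_inv a := rfl
  map_mul' M N := by simp [Matrix.mul_apply]
  map_add' M N := rfl
  commutes' c := by simp [algebraMap_matrix_apply]

lemma exists_dense_subalgebra_base {φ : A →A[ℂ] B} (h : IsCompletelyRelativelySpectral φ) :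
    ∃ X : Subalgebra ℂ A, Dense (X : Set A) ∧
      ∀ x ∈ X, spectrum ℂ (φ x) = spectrum ℂ x := by
  obtain ⟨X, hXd, hX⟩ := h 1 le_rfl
  refine ⟨X.map (oneByOneEquiv A : _ →ₐ[ℂ] A), ?_, ?_⟩
  · have hc : Continuous (oneByOneEquiv A) := (continuous_apply_apply 0 0 : Continuous
      fun M : Fin 1 → Fin 1 → A => M 0 0)
    exact (oneByOneEquiv A).surjective.denseRange.dense_image hc hXd
  · rintro _ ⟨x, hx, rfl⟩
    have h1 : φ (oneByOneEquiv A x) =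
        oneByOneEquiv B (AlgHom.mapMatrix (m := Fin 1) (φ : A →ₐ[ℂ] B) x) := rfl
    change spectrum ℂ (φ (oneByOneEquiv A x)) = spectrum ℂ (oneByOneEquiv A x)
    rw [h1, AlgEquiv.spectrum_eq, AlgEquiv.spectrum_eq, hX x hx]

end MatrixMap

/-! ### Stable ranks -/

section Lg

attribute [local instance] matrixNormedRing matrixNormedAlgebra completeSpace_matrix

variable {A B : Type*} [NormedRing A] [NormedRing B] {m : ℕ}

lemma mem_Lg_iff {a : Fin m → A} : a ∈ Lg A m ↔ ∃ c : Fin m → A, c ⬝ᵥ a = 1 := by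
  rw [Lg, Set.mem_ofPred_eq, Ideal.eq_top_iff_one, Ideal.mem_span_range_iff_exists_fun]
  rfl

lemma mem_Lg_of_isUnit {a c : Fin m → A} (h : IsUnit (c ⬝ᵥ a)) : a ∈ Lg A m := by
  obtain ⟨u, hu⟩ := h
  exact mem_Lg_iff.2 ⟨(u⁻¹ : Aˣ).1 • c, by rw [smul_dotProduct, ← hu, smul_eq_mul, Units.inv_mul]⟩

lemma mulVec_mem_Lg (g : GL (Fin m) A) {a : Fin m → A} (ha : a ∈ Lg A m) : g.1 *ᵥ a ∈ Lg A m := by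
  obtain ⟨c, hc⟩ := mem_Lg_iff.1 ha
  refine mem_Lg_iff.2 ⟨c ᵥ* (g⁻¹).1, ?_⟩
  rw [← dotProduct_mulVec, mulVec_mulVec, Units.inv_mul, one_mulVec, hc]

lemma map_mem_Lg (φ : A →+* B) {a : Fin m → A} (ha : a ∈ Lg A m) : φ ∘ a ∈ Lg B m := by
  obtain ⟨c, hc⟩ := mem_Lg_iff.1 ha
  exact mem_Lg_iff.2 ⟨φ ∘ c, by rw [← RingHom.map_dotProduct, hc, map_one]⟩

/-- If `c ⬝ᵥ a = 1`, then `c ⬝ᵥ b` remains a unit for `b` near `a`. -/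
lemma isOpen_Lg [CompleteSpace A] : IsOpen (Lg A m) := by
  refine isOpen_iff_mem_nhds.2 fun a ha => ?_
  obtain ⟨c, hc⟩ := mem_Lg_iff.1 ha
  have hcont : Continuous fun b : Fin m → A => c ⬝ᵥ b := by unfold dotProduct; fun_prop
  have : IsOpen {b : Fin m → A | IsUnit (c ⬝ᵥ b)} := Units.isOpen.preimage hcont
  exact Filter.mem_of_superset (this.mem_nhds (by simp [hc])) fun b hb => mem_Lg_of_isUnit hb

variable [NormedAlgebra ℂ A] [NormedAlgebra ℂ B]

/-- The entrywise map `Aᵐ → Bᵐ`. -/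
noncomputable def tupleMap (φ : A →A[ℂ] B) (m : ℕ) : (Fin m → A) →L[ℝ] (Fin m → B) :=
  ContinuousLinearMap.pi fun i =>
    (φ.toContinuousLinearMap.restrictScalars ℝ).comp (ContinuousLinearMap.proj i)

lemma denseRange_tupleMap {φ : A →A[ℂ] B} (hφ : DenseRange φ) : DenseRange (tupleMap φ m) :=
  DenseRange.piMap fun _ => hφ

variable {φ : A →A[ℂ] B} {X : Subalgebra ℂ A}

lemma mapsTo_tupleMap : Set.MapsTo (tupleMap φ m) (Lg A m) (Lg B m) :=
  fun _ ha => map_mem_Lg (φ : A →+* B) ha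

lemma tupleMap_mulVec (g : Matrix (Fin m) (Fin m) A) (a : Fin m → A) :
    tupleMap φ m (g *ᵥ a) = matrixMap φ m g *ᵥ tupleMap φ m a :=
  funext fun i => RingHom.map_mulVec (φ : A →+* B) g a i

/-- The tuples with entries in `X`. -/
noncomputable def tuples (X : Subalgebra ℂ A) (m : ℕ) : Submodule ℝ (Fin m → A) :=
  Submodule.pi Set.univ fun _ => X.toSubmodule.restrictScalars ℝ

lemma mem_tuples {a : Fin m → A} : a ∈ tuples X m ↔ ∀ i, a i ∈ X := by
  simp [tuples, Submodule.mem_pi]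

lemma dense_tuples (hXd : Dense (X : Set A)) : Dense (tuples X m : Set (Fin m → A)) := by
  have : (tuples X m : Set (Fin m → A)) = Set.univ.pi fun _ => (X : Set A) := by
    ext a; simp [mem_tuples]
  rw [this]
  exact dense_pi _ fun _ _ => hXd

lemma joinedIn_Lg_map {a b : Fin m → A} (h : JoinedIn (Lg A m) a b) :
    JoinedIn (Lg B m) (tupleMap φ m a) (tupleMap φ m b) :=
  (h.map (tupleMap φ m).continuous).mono mapsTo_tupleMap.image_subset

variable [CompleteSpace A]

lemma locallyPathConnectedSpace_units (R : Type*) [NormedRing R] [NormedAlgebra ℂ R]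
    [CompleteSpace R] : LocallyPathConnectedSpace Rˣ :=
  Units.isOpenEmbedding_val.locallyPathConnectedSpace

/-- Two unimodular tuples are in the same orbit of the identity component of `GLₘ(A)` if and only if
they are joined by a path of unimodular tuples. -/
theorem joinedIn_Lg_iff {a b : Fin m → A} (ha : a ∈ Lg A m) :
    JoinedIn (Lg A m) a b ↔
      ∃ g ∈ Subgroup.connectedComponentOfOne (GL (Fin m) A), g.1 *ᵥ a = b := by
  have : LocallyPathConnectedSpace (GL (Fin m) A) :=
    locallyPathConnectedSpace_units (Matrix (Fin m) (Fin m) A)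
  set G := Subgroup.connectedComponentOfOne (GL (Fin m) A) with hG
  constructor
  · rintro ⟨γ, hγ⟩
    let P : unitInterval → unitInterval → Prop := fun s t => ∃ g ∈ G, g.1 *ᵥ γ s = γ t
    have hsymm : Std.Symm P := ⟨fun s t ⟨g, hg, h⟩ => ⟨g⁻¹, G.inv_mem hg, by
      rw [← h, mulVec_mulVec, Units.inv_mul, one_mulVec]⟩⟩
    have htrans : IsTrans unitInterval P := ⟨fun r s t ⟨g, hg, h⟩ ⟨g', hg', h'⟩ =>
      ⟨g' * g, G.mul_mem hg' hg, by rw [← h', ← h, mulVec_mulVec]; rfl⟩⟩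
    have hP : ∀ s, ∀ᶠ t in 𝓝 s, P s t := by
      intro s
      obtain ⟨c, hc⟩ := mem_Lg_iff.1 (hγ s)
      -- Since `c ⬝ᵥ γ s = 1`, the matrix `M t` sends `γ s` to `γ t`. It is 1 at `t = s`, hence in
      -- the open identity component for `t` near `s`; connectedness of the interval then chains
      -- these local moves.
      let M : unitInterval → Matrix (Fin m) (Fin m) A :=
        fun t => 1 + vecMulVec (γ t - γ s) c
      have hM : Continuous M := by
        refine continuous_const.add (continuous_matrix fun i j => ?_)
        simp only [vecMulVec_apply]
        fun_prop
      have hopen : IsOpen ((fun g : GL (Fin m) A => g.1) '' (G : Set (GL (Fin m) A))) :=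
        Units.isOpenMap_val _ isOpen_connectedComponent
      have hMs : M s ∈ (fun g : GL (Fin m) A => g.1) '' (G : Set (GL (Fin m) A)) :=
        ⟨1, G.one_mem, by simp [M]⟩
      filter_upwards [hM.continuousAt.eventually_mem (hopen.mem_nhds hMs)] with t ht
      obtain ⟨g, hg, hgt⟩ := ht
      refine ⟨g, hg, ?_⟩
      simp only at hgt
      rw [hgt, add_mulVec, one_mulVec, vecMulVec_mulVec, hc]
      ext i
      simp
    obtain ⟨g, hg, h⟩ := PreconnectedSpace.induction₂ P hP htrans 0 1
    exact ⟨g, hg, by simpa using h⟩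
  · rintro ⟨g, hg, rfl⟩
    -- The unit group is locally path connected, so its identity component is path connected.
    have hg' : g ∈ pathComponent (1 : GL (Fin m) A) := by
      rw [pathComponent_eq_connectedComponent]; exact hg
    have hj : JoinedIn Set.univ (1 : GL (Fin m) A) g := joinedIn_univ.2 hg'
    have hc : Continuous fun g : GL (Fin m) A => g.1 *ᵥ a :=
      Units.continuous_val.matrix_mulVec continuous_const
    have := (hj.map hc).mono (V := Lg A m) (by rintro _ ⟨g, -, rfl⟩; exact mulVec_mem_Lg g ha)
    simpa using this

lemma actsTransitivelyOnLg_connectedComponent_iff :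
    ActsTransitivelyOnLg A m (Subgroup.connectedComponentOfOne (GL (Fin m) A)) ↔
      ∀ a ∈ Lg A m, ∀ b ∈ Lg A m, JoinedIn (Lg A m) a b :=
  forall₂_congr fun _ ha => forall₂_congr fun _ _ => (joinedIn_Lg_iff ha).symm

lemma exists_mulVec_eq_of_joinedIn {a b : Fin m → A} (h : JoinedIn (Lg A m) a b) :
    ∃ g : GL (Fin m) A, g.1 *ᵥ a = b :=
  let ⟨g, _, hg⟩ := (joinedIn_Lg_iff h.source_mem).1 h
  ⟨g, hg⟩

variable [CompleteSpace B]

variable (hφ : DenseRange φ) (hXd : Dense (X : Set A))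
  (hX : ∀ x ∈ X, spectrum ℂ (φ x) = spectrum ℂ x)

include hφ hXd hX

-- The left inverse row over `B` can be perturbed to the image of a row `d` over `X` with the
-- product still a unit; then `d ⬝ᵥ x` lies in `X` and is a unit of `A`.
omit [CompleteSpace A] in
lemma mem_Lg_of_map (x : Fin m → A) (hx : x ∈ tuples X m) (h : tupleMap φ m x ∈ Lg B m) :
    x ∈ Lg A m := by
  obtain ⟨c, hc⟩ := mem_Lg_iff.1 h
  have hcont : Continuous fun b : Fin m → B => b ⬝ᵥ tupleMap φ m x := by
    unfold dotProduct; fun_prop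
  have ho : IsOpen {b : Fin m → B | IsUnit (b ⬝ᵥ tupleMap φ m x)} := Units.isOpen.preimage hcont
  obtain ⟨_, hu, d, hd, rfl⟩ :=
    ((denseRange_tupleMap hφ).dense_image (tupleMap φ m).continuous
      (dense_tuples hXd)).inter_open_nonempty _ ho ⟨c, by simp [hc]⟩
  refine mem_Lg_of_isUnit (c := d) (isUnit_of_isUnit_map hX ?_ (f := φ) ?_)
  · exact X.sum_mem fun i _ => X.mul_mem (mem_tuples.1 hd i) (mem_tuples.1 hx i)
  · have : φ (d ⬝ᵥ x) = tupleMap φ m d ⬝ᵥ tupleMap φ m x := RingHom.map_dotProduct (φ : A →+* B) d x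
    rw [this]; exact hu

lemma joinedIn_Lg_of_map {a b : Fin m → A} (ha : a ∈ Lg A m) (hb : b ∈ Lg A m)
    (h : JoinedIn (Lg B m) (tupleMap φ m a) (tupleMap φ m b)) : JoinedIn (Lg A m) a b :=
  joinedIn_of_joinedIn_map (dense_tuples hXd) (denseRange_tupleMap hφ) isOpen_Lg isOpen_Lg
    mapsTo_tupleMap (mem_Lg_of_map hφ hXd hX) ha hb h

omit [CompleteSpace A] in
lemma exists_joinedIn_Lg_map {b : Fin m → B} (hb : b ∈ Lg B m) :
    ∃ a ∈ Lg A m, JoinedIn (Lg B m) b (tupleMap φ m a) :=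
  let ⟨x, _, hx, h⟩ := exists_joinedIn_map (dense_tuples hXd) (denseRange_tupleMap hφ) isOpen_Lg
    (mem_Lg_of_map hφ hXd hX) hb
  ⟨x, hx, h⟩

lemma actsTransitivelyOnLg_connectedComponent_congr :
    ActsTransitivelyOnLg A m (Subgroup.connectedComponentOfOne (GL (Fin m) A)) ↔
      ActsTransitivelyOnLg B m (Subgroup.connectedComponentOfOne (GL (Fin m) B)) := by
  rw [actsTransitivelyOnLg_connectedComponent_iff, actsTransitivelyOnLg_connectedComponent_iff]
  constructor
  · intro h b hb b' hb'
    obtain ⟨a, ha, hj⟩ := exists_joinedIn_Lg_map hφ hXd hX hb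
    obtain ⟨a', ha', hj'⟩ := exists_joinedIn_Lg_map hφ hXd hX hb'
    exact hj.trans ((joinedIn_Lg_map (h a ha a' ha')).trans hj'.symm)
  · intro h a ha a' ha'
    exact joinedIn_Lg_of_map hφ hXd hX ha ha'
      (h _ (mapsTo_tupleMap ha) _ (mapsTo_tupleMap ha'))

theorem csr_eq : csr A = csr B := by
  simp only [csr, actsTransitivelyOnLg_connectedComponent_congr hφ hXd hX]

/-- From `A` to `B`, tuples are first moved along paths to images of tuples over `A`. From `B` to
`A`, a matrix over `B` is deformed to the image of an invertible matrix over `A`, and the remaining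
path of tuples is lifted. -/
lemma actsTransitivelyOnLg_top_congr {Y : Subalgebra ℂ (Matrix (Fin m) (Fin m) A)}
    (hYd : Dense (Y : Set (Matrix (Fin m) (Fin m) A)))
    (hY : ∀ y ∈ Y, spectrum ℂ (matrixMap φ m y) = spectrum ℂ y) :
    ActsTransitivelyOnLg A m ⊤ ↔ ActsTransitivelyOnLg B m ⊤ := by
  constructor
  · intro h b hb b' hb'
    obtain ⟨a, ha, hj⟩ := exists_joinedIn_Lg_map hφ hXd hX hb
    obtain ⟨a', ha', hj'⟩ := exists_joinedIn_Lg_map hφ hXd hX hb'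
    obtain ⟨g, -, hg⟩ := h a ha a' ha'
    obtain ⟨u, hu⟩ := exists_mulVec_eq_of_joinedIn hj
    obtain ⟨v, hv⟩ := exists_mulVec_eq_of_joinedIn hj'.symm
    refine ⟨v * (glMap φ m g * u), trivial, ?_⟩
    have hg' : (glMap φ m g).1 *ᵥ tupleMap φ m a = tupleMap φ m a' := by
      rw [← hg, tupleMap_mulVec]; rfl
    rw [Units.val_mul, Units.val_mul, ← mulVec_mulVec, ← mulVec_mulVec, hu, hg', hv]
  · intro h a ha a' ha'
    obtain ⟨u, -, hu⟩ := h _ (mapsTo_tupleMap (φ := φ) ha) _ (mapsTo_tupleMap ha')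
    -- The path from `u` to the image of `y`, applied to the image of `a`, joins the images of `a'`
    -- and `y *ᵥ a` inside `Lg B m`.
    obtain ⟨y, -, hy, hj⟩ := exists_joinedIn_map
      (T := (matrixMap φ m).toContinuousLinearMap.restrictScalars ℝ)
      (X := Y.toSubmodule.restrictScalars ℝ) (U := {y | IsUnit y}) hYd (denseRange_matrixMap hφ m)
      Units.isOpen (fun y hy => isUnit_of_isUnit_map hY hy) u.isUnit
    obtain ⟨g, rfl⟩ := hy
    have hc : Continuous fun M : Matrix (Fin m) (Fin m) B => M *ᵥ tupleMap φ m a :=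
      continuous_id.matrix_mulVec continuous_const
    have hj' := (hj.map hc).mono (V := Lg B m) (by
      rintro _ ⟨_, ⟨w, rfl⟩, rfl⟩
      exact mulVec_mem_Lg w (mapsTo_tupleMap ha))
    simp only [hu] at hj'
    have hga := mulVec_mem_Lg g ha
    have hj'' : JoinedIn (Lg B m) (tupleMap φ m (g.1 *ᵥ a)) (tupleMap φ m a') := by
      rw [tupleMap_mulVec]; exact hj'.symm
    obtain ⟨w, hw⟩ := exists_mulVec_eq_of_joinedIn (joinedIn_Lg_of_map hφ hXd hX hga ha' hj'')
    exact ⟨w * g, trivial, by rw [Units.val_mul, ← mulVec_mulVec, hw]⟩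

end Lg

/-! ### K-theory -/

section KTheory

attribute [local instance] matrixNormedRing matrixNormedAlgebra completeSpace_matrix

theorem bijective_directLimit_map {ι : Type*} [Preorder ι] [IsDirectedOrder ι]
    {F₁ F₂ : ι → Type*} {T₁ : ∀ ⦃i j : ι⦄, i ≤ j → Type*} {T₂ : ∀ ⦃i j : ι⦄, i ≤ j → Type*}
    {f₁ : ∀ i j (h : i ≤ j), T₁ h} {f₂ : ∀ i j (h : i ≤ j), T₂ h}
    [∀ i j (h : i ≤ j), FunLike (T₁ h) (F₁ i) (F₁ j)] [DirectedSystem F₁ (f₁ · · ·)]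
    [∀ i j (h : i ≤ j), FunLike (T₂ h) (F₂ i) (F₂ j)] [DirectedSystem F₂ (f₂ · · ·)]
    {g : ∀ i, F₁ i → F₂ i} (hc : ∀ i j h x, f₂ i j h (g i x) = g j (f₁ i j h x))
    (hg : ∀ i, Function.Bijective (g i)) : Function.Bijective (DirectLimit.map f₁ f₂ g hc) := by
  constructor
  · refine DirectLimit.induction₂ _ fun i x y h => ?_
    obtain ⟨k, hk, hk', h⟩ := Quotient.exact h
    refine Quotient.sound ⟨k, hk, hk', (hg k).1 ?_⟩
    rw [← hc, ← hc]
    exact h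
  · refine DirectLimit.induction _ fun i y => ?_
    obtain ⟨x, rfl⟩ := (hg i).2 y
    exact ⟨⟦⟨i, x⟩⟧, rfl⟩

lemma grothendieckAddGroup_lift_of {M G : Type*} [AddCommMonoid M] [AddCommGroup G] (f : M →+ G)
    (x : M) :
    Algebra.GrothendieckAddGroup.lift f (Algebra.GrothendieckAddGroup.of x) = f x :=
  DFunLike.congr_fun (Algebra.GrothendieckAddGroup.lift.symm_apply_apply f) x

lemma grothendieckAddGroup_hom_ext {M G : Type*} [AddCommMonoid M] [AddCommGroup G]
    {u v : Algebra.GrothendieckAddGroup M →+ G} (h : ∀ x, u (Algebra.GrothendieckAddGroup.of x) =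
      v (Algebra.GrothendieckAddGroup.of x)) : u = v :=
  Algebra.GrothendieckAddGroup.lift.symm.injective (AddMonoidHom.ext h)

/-- Functoriality of the Grothendieck group, tested on the generators `of x`. -/
lemma leftInverse_grothendieckAddGroup_lift {M N : Type*} [AddCommMonoid M] [AddCommMonoid N]
    (f : M →+ N) (g : N →+ M) (h : ∀ x, g (f x) = x) :
    Function.LeftInverse
      (Algebra.GrothendieckAddGroup.lift (Algebra.GrothendieckAddGroup.of.comp g))
      (Algebra.GrothendieckAddGroup.lift (Algebra.GrothendieckAddGroup.of.comp f)) := by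
  refine DFunLike.congr_fun (grothendieckAddGroup_hom_ext
    (u := (Algebra.GrothendieckAddGroup.lift (Algebra.GrothendieckAddGroup.of.comp g)).comp
      (Algebra.GrothendieckAddGroup.lift (Algebra.GrothendieckAddGroup.of.comp f)))
    (v := AddMonoidHom.id _) fun x => ?_)
  rw [AddMonoidHom.comp_apply, grothendieckAddGroup_lift_of, AddMonoidHom.comp_apply,
    grothendieckAddGroup_lift_of, AddMonoidHom.comp_apply, h, AddMonoidHom.id_apply]

theorem bijective_grothendieckAddGroup_lift {M N : Type*} [AddCommMonoid M] [AddCommMonoid N]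
    (f : M →+ N) (hf : Function.Bijective f) :
    Function.Bijective (Algebra.GrothendieckAddGroup.lift
      (Algebra.GrothendieckAddGroup.of.comp f)) := by
  let e := AddEquiv.ofBijective f hf
  exact Function.bijective_iff_has_inverse.2 ⟨_, leftInverse_grothendieckAddGroup_lift f (e.symm : N →+ M) e.symm_apply_apply,
    leftInverse_grothendieckAddGroup_lift (e.symm : N →+ M) f e.apply_symm_apply⟩

variable {A B : Type*} [NormedRing A] [NormedAlgebra ℂ A] [CompleteSpace A]
  [NormedRing B] [NormedAlgebra ℂ B] [CompleteSpace B] {φ : A →A[ℂ] B}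

/-- Equality in the limit is witnessed at a finite stage `N`, so it suffices to treat each matrix
size separately; the dense subalgebras for different sizes need no compatibility. -/
theorem bijective_V_map (hφ : DenseRange φ) (h : IsCompletelyRelativelySpectral φ) :
    Function.Bijective (V.map φ) := by
  constructor
  · rintro ⟨⟨m, p⟩⟩ ⟨⟨n, q⟩⟩ hpq
    obtain ⟨N, hm, hn, hj⟩ := Quotient.exact hpq
    obtain ⟨X, hXd, hX⟩ := exists_dense_subalgebra h N
    refine Quotient.sound ⟨N, hm, hn, ?_⟩
    refine joined_of_joined_map hXd (denseRange_matrixMap hφ N) hX ?_ ?_ hj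
    · exact (congrArg Subtype.val (Idem.map_pad φ hm p)).symm
    · exact (congrArg Subtype.val (Idem.map_pad φ hn q)).symm
  · rintro ⟨⟨n, q⟩⟩
    obtain ⟨X, hXd, hX⟩ := exists_dense_subalgebra h n
    obtain ⟨p, hp⟩ := exists_joined_map hXd (denseRange_matrixMap hφ n) hX q
    exact ⟨V.mk p, (V.mk_eq_of_joined (hp (Idem.map φ p) rfl)).symm⟩

theorem bijective_KZero_map (hφ : DenseRange φ) (h : IsCompletelyRelativelySpectral φ) :
    Function.Bijective (KZero.map φ) :=
  bijective_grothendieckAddGroup_lift _ (bijective_V_map hφ h)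

omit [CompleteSpace A] [CompleteSpace B] in
lemma piGroup_map_glPad (φ : A →A[ℂ] B) (k : ℕ) {n N : ℕ} (h : n ≤ N)
    (x : PiGroup k (GL (Fin n) A)) :
    PiGroup.map k (glPad B h) (PiGroup.map k (glMap φ n) x) =
      PiGroup.map k (glMap φ N) (PiGroup.map k (glPad A h) x) := by
  obtain ⟨u, rfl⟩ := PiGroup.mk_surjective k x
  simp only [PiGroup.map_mk]
  congr 1
  ext y : 2
  have := pad_map (φ : A →+* B) h 1 (u.1 y).1
  rw [map_one] at this
  exact Units.ext this.symm

theorem bijective_KSucc_map (hφ : DenseRange φ) (h : IsCompletelyRelativelySpectral φ) (k : ℕ) :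
    Function.Bijective (KSucc.map φ k) := by
  refine bijective_directLimit_map (f₁ := fun _ _ h => PiGroup.map k (glPad A h))
    (f₂ := fun _ _ h => PiGroup.map k (glPad B h)) (g := fun n => PiGroup.map k (glMap φ n))
    (fun _ _ h x => piGroup_map_glPad φ k h x) fun n => ?_
  obtain ⟨X, hXd, hX⟩ := exists_dense_subalgebra h n
  exact bijective_piGroup_map hXd (denseRange_matrixMap hφ n) hX (fun _ => rfl) k

theorem gsr_eq (hφ : DenseRange φ) (h : IsCompletelyRelativelySpectral φ) : gsr A = gsr B := by
  obtain ⟨X, hXd, hX⟩ := exists_dense_subalgebra_base h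
  have key : ∀ m, ActsTransitivelyOnLg A m ⊤ ↔ ActsTransitivelyOnLg B m ⊤ := fun m =>
    let ⟨_, hYd, hY⟩ := exists_dense_subalgebra h m
    actsTransitivelyOnLg_top_congr hφ hXd hX hYd hY
  simp only [gsr, key]

end KTheory

end BanachAlg

theorem mainTheorem9 {A B : Type*}
    [NormedRing A] [NormedAlgebra ℂ A] [CompleteSpace A]
    [NormedRing B] [NormedAlgebra ℂ B] [CompleteSpace B]
    (φ : A →A[ℂ] B) (hdense : DenseRange φ)
    (hspec : BanachAlg.IsCompletelyRelativelySpectral φ) :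
    Function.Bijective (BanachAlg.KZero.map φ) ∧
    (∀ k : ℕ, Function.Bijective (BanachAlg.KSucc.map φ k)) ∧
    BanachAlg.csr A = BanachAlg.csr B ∧
    BanachAlg.gsr A = BanachAlg.gsr B := by
  obtain ⟨X, hXd, hX⟩ := BanachAlg.exists_dense_subalgebra_base hspec
  exact ⟨BanachAlg.bijective_KZero_map hdense hspec, BanachAlg.bijective_KSucc_map hdense hspec,
    BanachAlg.csr_eq hdense hXd hX, BanachAlg.gsr_eq hdense hspec⟩
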